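/- Given $\alpha \in (0,1)$, call a family of (distinct) lines through the origin of $\mathbb{R}^r$ (with the Euclidean inner product) $\alpha$-equiangular if the acute angle between any two distinct lines of the family equals $\arccos\alpha$. **Theorem 3.4.** Let $0<\alpha<1$ be a real number and let $r$ be an integer with $r \ge 2^{1/\alpha^{20}}$. Then every family of $\alpha$-equiangular lines in $\mathbb{R}^r$ is finite and consists of at most $$\left\lfloor \left(1+\frac{2\alpha}{1-\alpha}\right)(r-1) \right\rfloor$$ lines. -/

import Mathlib

/-- The acute angle (in `[0, π/2]`) spanned by the directions of two nonzero vectors `u` and `v`: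
it does not change when `u` or `v` is multiplied by a nonzero real number. -/
noncomputable def acuteAngle {V : Type*} [NormedAddCommGroup V] [InnerProductSpace ℝ V]
    (u v : V) : ℝ :=
  min (InnerProductGeometry.angle u v) (Real.pi - InnerProductGeometry.angle u v)

/-- A family of lines through the origin (one-dimensional linear subspaces) of a real inner
product space is `α`-equiangular if the acute angle between any two distinct lines of the family
equals `arccos α`. The angle of two lines is that of any nonzero vectors on them. -/
def IsEquiangularLines {V : Type*} [NormedAddCommGroup V] [InnerProductSpace ℝ V]
    (α : ℝ) (S : Set (Submodule ℝ V)) : Prop :=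
  (∀ L ∈ S, Module.finrank ℝ L = 1) ∧
    ∀ L ∈ S, ∀ L' ∈ S, L ≠ L' →
      ∀ u ∈ L, ∀ v ∈ L', u ≠ 0 → v ≠ 0 → acuteAngle u v = Real.arccos α

/-!
The lines are represented by unit vectors with inner products `±α`, and `A` is the adjacency matrix
of the graph `G` of negative inner products. With `c = (1 - α) / (2α)`, the Gram matrix is
`2α (c - A) + α J`, so a linear dependency of zero sum is an eigenvector of `A` for the eigenvalue
`c`, and `c - A` is nonnegative on the vectors of zero sum (`norm_sq_sum_eq`). As the claimed bound
is `(1 + 1 / c) (r - 1)`, it suffices to show that the multiplicity of `c` is less than the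
proportion `1 / (c + 1)` of the number `N` of vertices, with some care for additive constants
(`card_le_of_vectors`).

If `c - A` is nonnegative everywhere, the eigenspace is a sublattice, the projection `Π` onto it has
nonnegative entries, and comparing `A + 1` with the all-ones matrix gives
`(c + 1) tr Π ≤ 1ᵀ Π 1 ≤ N` (`mul_card_le`).

Otherwise `A` has exactly one eigenvalue above `c`. By Ramsey's theorem, the signs can be chosen such
that `G` has degrees at most about `c ^ 2` (`exists_switching`). Balls of spectral radius above `c`
pairwise meet or touch, so they have few centres (`card_not_nonnegOn_le`). Around any other vertex
the form `c - A` is nonnegative, and eigenvectors that are cut off slowly are almost null vectors of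
it (`form_cutoff_le`). Almost null vectors form an approximate lattice: the positive part of a
combination of two of them that vanishes at a vertex is almost zero at its neighbours, so that any
two of them are almost proportional along edges (`NonnegOn.mul_le_of_adj`). Hence `Π` is almost of
rank one on each connected block of vertices whose diagonal entry in `Π` is not small
(`projKernel_rigid`), and the mass `∑ Π u u` of a block is at most about `1`
(`Admissible.sum_block_le`). This rigidity keeps all blocks small. Therefore a block has spectral
radius at most `c`, even together with a neighbour outside it, which exists because of
`Admissible.exists_adj_block`. So it spans less than `c / 2` times as many edges as it has vertices,
and to carry eigenvectors for `c` it needs definitely more than `c + 1` vertices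
(`Admissible.sum_block_le_card`). Summing over the blocks bounds the trace of `Π`
(`Admissible.card_le`, `card_add_two_le`).
-/

set_option linter.unusedSectionVars false

namespace Equiangular

open Finset

section

variable {V : Type*} [Fintype V] [DecidableEq V] (G : SimpleGraph V) [DecidableRel G.Adj] (c : ℝ)

/-! ### The quadratic form of `c - A` -/

/-- The symmetric bilinear form `xᵀ (c - A) y`, where `A` is the adjacency matrix of `G`. -/
noncomputable def form (x y : V → ℝ) : ℝ :=
  ∑ u, ∑ v, ((if u = v then c else 0) - G.adjMatrix ℝ u v) * (x u * y v)

/-- The form `c - A` is nonnegative on the vectors supported in `Ω`, that is, the subgraph of `G`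
induced on `Ω` has spectral radius at most `c`. -/
def NonnegOn (Ω : Finset V) : Prop :=
  ∀ x : V → ℝ, (∀ u ∉ Ω, x u = 0) → 0 ≤ form G c x x

variable {G c}

theorem adj_symm (u v : V) : G.adjMatrix ℝ u v = G.adjMatrix ℝ v u := by
  simp [SimpleGraph.adjMatrix_apply, SimpleGraph.adj_comm]

theorem adj_nonneg (u v : V) : 0 ≤ G.adjMatrix ℝ u v := by
  rw [SimpleGraph.adjMatrix_apply]; split_ifs <;> norm_num

theorem form_comm (x y : V → ℝ) : form G c x y = form G c y x := by
  unfold form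
  rw [sum_comm]
  refine sum_congr rfl fun u _ => sum_congr rfl fun v _ => ?_
  rw [adj_symm v u, mul_comm (x v)]
  simp only [eq_comm]

theorem form_eq_sum_mul (x y : V → ℝ) :
    form G c x y = ∑ u, x u * (c * y u - ∑ v, G.adjMatrix ℝ u v * y v) := by
  unfold form
  refine sum_congr rfl fun u _ => ?_
  simp only [sub_mul, sum_sub_distrib, mul_sub, mul_sum, ite_mul, zero_mul, sum_ite_eq, mem_univ,
    if_true]
  congr 1
  · ring
  · exact sum_congr rfl fun v _ => by ring

theorem form_eq (x y : V → ℝ) :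
    form G c x y = c * ∑ u, x u * y u - ∑ u, ∑ v, G.adjMatrix ℝ u v * (x u * y v) := by
  rw [form_eq_sum_mul, mul_sum, ← sum_sub_distrib]
  refine sum_congr rfl fun u _ => ?_
  rw [mul_sub, mul_sum]
  congr 1
  · ring
  · exact sum_congr rfl fun v _ => by ring

theorem form_comb (a b : ℝ) (x y : V → ℝ) :
    form G c (fun u => a * x u + b * y u) (fun u => a * x u + b * y u) =
      a ^ 2 * form G c x x + 2 * a * b * form G c x y + b ^ 2 * form G c y y := by
  have h : 2 * a * b * form G c x y = a * b * form G c x y + a * b * form G c y x := by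
    rw [form_comm y x]; ring
  rw [h]
  unfold form
  simp only [mul_sum, ← sum_add_distrib]
  exact sum_congr rfl fun u _ => sum_congr rfl fun v _ => by ring

theorem form_single_left (u : V) (y : V → ℝ) :
    form G c (Pi.single u 1) y = c * y u - ∑ v, G.adjMatrix ℝ u v * y v := by
  rw [form_eq_sum_mul, sum_eq_single u]
  · simp
  · intro v _ hv; simp [hv]
  · simp

theorem form_single_single (u : V) : form G c (Pi.single u 1) (Pi.single u 1) = c := by
  rw [form_single_left]
  simp [Pi.single_apply]

theorem form_nonpos_of_disjoint {x y : V → ℝ} (hx : ∀ u, 0 ≤ x u) (hy : ∀ u, 0 ≤ y u)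
    (h : ∀ u, x u * y u = 0) : form G c x y ≤ 0 := by
  rw [form_eq]
  simp only [h, sum_const_zero, mul_zero, zero_sub, neg_nonpos]
  exact sum_nonneg fun u _ => sum_nonneg fun v _ =>
    mul_nonneg (adj_nonneg _ _) (mul_nonneg (hx _) (hy _))

theorem form_max_nonpos (x : V → ℝ) :
    form G c (fun u => max (x u) 0) (fun u => max (-x u) 0) ≤ 0 := by
  refine form_nonpos_of_disjoint (fun u => le_max_right _ _) (fun u => le_max_right _ _) fun u => ?_
  rcases le_total 0 (x u) with h | h
  · rw [max_eq_right (neg_nonpos.2 h), mul_zero]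
  · rw [max_eq_right h, zero_mul]

theorem form_posPart_add_negPart_le (x : V → ℝ) :
    form G c (fun u => max (x u) 0) (fun u => max (x u) 0) +
      form G c (fun u => max (-x u) 0) (fun u => max (-x u) 0) ≤ form G c x x := by
  have h := form_comb (G := G) (c := c) 1 (-1) (fun u => max (x u) 0) (fun u => max (-x u) 0)
  have e : (fun u => 1 * max (x u) 0 + -1 * max (-x u) 0) = x := by
    funext u
    rcases le_total 0 (x u) with h | h
    · rw [max_eq_right (neg_nonpos.2 h), max_eq_left h]; ring
    · rw [max_eq_right h, max_eq_left (neg_nonneg.2 h)]; ring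
  simp only [e] at h
  have := form_max_nonpos (G := G) (c := c) x
  linarith

theorem form_abs_le (x : V → ℝ) : form G c (fun u => |x u|) (fun u => |x u|) ≤ form G c x x := by
  have h := form_comb (G := G) (c := c) 1 1 (fun u => max (x u) 0) (fun u => max (-x u) 0)
  have e : (fun u => 1 * max (x u) 0 + 1 * max (-x u) 0) = fun u => |x u| := by
    funext u
    rcases le_total 0 (x u) with h | h
    · rw [max_eq_right (neg_nonpos.2 h), max_eq_left h, abs_of_nonneg h]; ring
    · rw [max_eq_right h, max_eq_left (neg_nonneg.2 h), abs_of_nonpos h]; ring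
  simp only [e] at h
  have := form_max_nonpos (G := G) (c := c) x
  have := form_posPart_add_negPart_le (G := G) (c := c) x
  linarith

theorem NonnegOn.sq_form_le {Ω : Finset V} (h : NonnegOn G c Ω) {x y : V → ℝ}
    (hx : ∀ u ∉ Ω, x u = 0) (hy : ∀ u ∉ Ω, y u = 0) :
    form G c x y ^ 2 ≤ form G c x x * form G c y y := by
  have key : ∀ t : ℝ, 0 ≤ form G c y y * (t * t) + 2 * form G c x y * t + form G c x x := by
    intro t
    have h1 := h (fun u => 1 * x u + t * y u) fun u hu => by rw [hx u hu, hy u hu]; ring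
    rw [form_comb] at h1
    linarith
  have := discrim_le_zero key
  unfold discrim at this
  nlinarith

/-- If the form `c - A` is almost degenerate at `x`, then `x` almost satisfies the eigenvector
equation, pointwise. -/
theorem NonnegOn.abs_eigen_le {Ω : Finset V} (h : NonnegOn G c Ω) {x : V → ℝ}
    (hx : ∀ u ∉ Ω, x u = 0) {κ : ℝ} (hκ : 0 ≤ κ) (hf : c * form G c x x ≤ κ ^ 2) {u : V}
    (hu : u ∈ Ω) : |c * x u - ∑ v, G.adjMatrix ℝ u v * x v| ≤ κ := by
  rw [← form_single_left]
  refine abs_le_of_sq_le_sq ?_ hκ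
  have := h.sq_form_le (x := Pi.single u 1) (y := x)
    (fun w hw => Pi.single_eq_of_ne (by rintro rfl; exact hw hu) _) hx
  rw [form_single_single] at this
  linarith

/-- Two nonnegative, almost degenerate vectors are almost proportional along every edge. -/
theorem NonnegOn.mul_le_of_adj {Ω : Finset V} (h : NonnegOn G c Ω) (hc : 0 ≤ c) {f g : V → ℝ}
    (hf0 : ∀ u, 0 ≤ f u) (hg0 : ∀ u, 0 ≤ g u) (hf : ∀ u ∉ Ω, f u = 0) (hg : ∀ u ∉ Ω, g u = 0)
    {ε κ : ℝ} (hκ : 0 ≤ κ) (hεκ : c * ε ≤ κ ^ 2) (hfε : form G c f f ≤ ε)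
    (hgε : form G c g g ≤ ε) {u v : V} (hu : u ∈ Ω) (huv : G.Adj u v) :
    g u * f v ≤ f u * g v + κ * (f u + g u) := by
  -- The positive part of `g u • f - f u • g` vanishes at `u` and is almost degenerate.
  set z : V → ℝ := fun w => g u * f w + (-f u) * g w with hz
  have hε : 0 ≤ ε := (h f hf).trans hfε
  have hcs : |form G c f g| ≤ ε := by
    refine abs_le_of_sq_le_sq ?_ hε
    refine (h.sq_form_le hf hg).trans ?_
    rw [sq]
    exact mul_le_mul hfε hgε (h g hg) hε
  have hzε : form G c z z ≤ (f u + g u) ^ 2 * ε := by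
    rw [hz, form_comb]
    have h1 : g u ^ 2 * form G c f f ≤ g u ^ 2 * ε := mul_le_mul_of_nonneg_left hfε (sq_nonneg _)
    have h2 : (-f u) ^ 2 * form G c g g ≤ (-f u) ^ 2 * ε :=
      mul_le_mul_of_nonneg_left hgε (sq_nonneg _)
    have h3 : (2 * (g u * f u)) * -form G c f g ≤ (2 * (g u * f u)) * ε :=
      mul_le_mul_of_nonneg_left (by linarith [(abs_le.1 hcs).1])
        (by have := mul_nonneg (hg0 u) (hf0 u); linarith)
    nlinarith
  have hz0 : ∀ w ∉ Ω, z w = 0 := fun w hw => by simp only [hz, hf w hw, hg w hw]; ring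
  have hp : form G c (fun w => max (z w) 0) (fun w => max (z w) 0) ≤ (f u + g u) ^ 2 * ε := by
    have h1 := form_posPart_add_negPart_le (G := G) (c := c) z
    have h2 := h (fun w => max (-z w) 0) fun w hw => by simp [hz0 w hw]
    linarith
  have hfg : 0 ≤ f u + g u := add_nonneg (hf0 u) (hg0 u)
  have h1 := h.abs_eigen_le (x := fun w => max (z w) 0) (fun w hw => by simp [hz0 w hw])
    (κ := κ * (f u + g u)) (mul_nonneg hκ hfg) (by
      have := mul_le_mul_of_nonneg_left hp hc
      have h5 := mul_le_mul_of_nonneg_left hεκ (sq_nonneg (f u + g u))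
      nlinarith) hu
  have hzu : max (z u) 0 = 0 := by
    have : z u = 0 := by simp only [hz]; ring
    rw [this, max_self]
  rw [hzu, mul_zero, zero_sub, abs_neg] at h1
  have h2 : max (z v) 0 ≤ ∑ w, G.adjMatrix ℝ u w * max (z w) 0 := by
    have := single_le_sum (f := fun w => G.adjMatrix ℝ u w * max (z w) 0) (s := univ)
      (fun w _ => mul_nonneg (adj_nonneg _ _) (le_max_right _ _)) (mem_univ v)
    simpa [SimpleGraph.adjMatrix_apply, huv] using this
  have h3 := (le_max_left (z v) 0).trans (h2.trans ((le_abs_self _).trans h1))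
  simp only [hz] at h3
  linarith

/-- Along a path on which `f` stays above `σ`, the ratio of two nonnegative, almost degenerate
vectors `f` and `g` is almost constant. -/
theorem NonnegOn.chain {Ω : Finset V} (h : NonnegOn G c Ω) (hc : 0 ≤ c) {f g : V → ℝ}
    (hf0 : ∀ u, 0 ≤ f u) (hg0 : ∀ u, 0 ≤ g u) (hf : ∀ u ∉ Ω, f u = 0) (hg : ∀ u ∉ Ω, g u = 0)
    {ε κ σ : ℝ} (hκ : 0 ≤ κ) (hεκ : c * ε ≤ κ ^ 2) (hfε : form G c f f ≤ ε)
    (hgε : form G c g g ≤ ε) (hσ : 0 < σ) (hκσ : κ ≤ σ) (p : ℕ → V) (n : ℕ)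
    (hp : ∀ j ≤ n, p j ∈ Ω) (hadj : ∀ j < n, G.Adj (p j) (p (j + 1)))
    (hfσ : ∀ j < n, σ ≤ f (p j)) :
    (f (p n) + g (p n)) * f (p 0) * (1 - κ / σ) ^ n ≤ f (p n) * (f (p 0) + g (p 0)) := by
  have hq : 0 ≤ 1 - κ / σ := by rw [sub_nonneg, div_le_one hσ]; exact hκσ
  induction n with
  | zero => simp; linarith [mul_comm (f (p 0)) (f (p 0) + g (p 0))]
  | succ n ih =>
    have ih := ih (fun j hj => hp j (by omega)) (fun j hj => hadj j (by omega))
      (fun j hj => hfσ j (by omega))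
    have hfn := hfσ n (by omega)
    have hpos : 0 < f (p n) := hσ.trans_le hfn
    have step := h.mul_le_of_adj hc hf0 hg0 hf hg hκ hεκ hfε hgε (hp (n + 1) le_rfl)
      (hadj n (by omega)).symm
    have hh : 0 ≤ f (p (n + 1)) + g (p (n + 1)) := add_nonneg (hf0 _) (hg0 _)
    have hstep : (f (p (n + 1)) + g (p (n + 1))) * (f (p n) * (1 - κ / σ)) ≤
        f (p (n + 1)) * (f (p n) + g (p n)) := by
      have h1 : f (p n) * (1 - κ / σ) ≤ f (p n) - κ := by
        have : κ ≤ f (p n) * (κ / σ) := by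
          rw [mul_div_assoc', le_div_iff₀ hσ, mul_comm κ]
          exact mul_le_mul_of_nonneg_right hfn hκ
        linarith
      have h2 := mul_le_mul_of_nonneg_left h1 hh
      nlinarith
    refine le_of_mul_le_mul_left ?_ hpos
    calc f (p n) * ((f (p (n + 1)) + g (p (n + 1))) * f (p 0) * (1 - κ / σ) ^ (n + 1))
        = (f (p (n + 1)) + g (p (n + 1))) * (f (p n) * (1 - κ / σ)) *
            (f (p 0) * (1 - κ / σ) ^ n) := by ring
      _ ≤ f (p (n + 1)) * (f (p n) + g (p n)) * (f (p 0) * (1 - κ / σ) ^ n) :=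
          mul_le_mul_of_nonneg_right hstep (mul_nonneg (hf0 _) (pow_nonneg hq _))
      _ = f (p (n + 1)) * ((f (p n) + g (p n)) * f (p 0) * (1 - κ / σ) ^ n) := by ring
      _ ≤ f (p (n + 1)) * (f (p n) * (f (p 0) + g (p 0))) :=
          mul_le_mul_of_nonneg_left ih (hf0 _)
      _ = f (p n) * (f (p (n + 1)) * (f (p 0) + g (p 0))) := by ring

/-- If `c - A` is nonnegative on the vectors with zero sum, it cannot be negative at `x` and
nonpositive at a nonzero nonnegative vector `y` that is orthogonal to `x` for the form. -/
theorem false_of_separated (H : ∀ x : V → ℝ, ∑ u, x u = 0 → 0 ≤ form G c x x) {x y : V → ℝ}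
    (hy : ∀ u, 0 ≤ y u) (hxx : form G c x x < 0) (hyy : form G c y y ≤ 0)
    (hy0 : ∃ u, y u ≠ 0) (hxy : form G c x y = 0) : False := by
  obtain ⟨w, hw⟩ := hy0
  have hsy : 0 < ∑ u, y u :=
    sum_pos' (fun u _ => hy u) ⟨w, mem_univ w, lt_of_le_of_ne (hy w) hw.symm⟩
  have h1 := H (fun u => 1 * x u + (-((∑ u, x u) / ∑ u, y u)) * y u) (by
    rw [sum_add_distrib, ← mul_sum, ← mul_sum]; field_simp; ring)
  rw [form_comb, hxy] at h1
  have := mul_nonneg (sq_nonneg (-((∑ u, x u) / ∑ u, y u))) (neg_nonneg.2 hyy)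
  linarith

end

section

variable {V : Type*} [Fintype V] [DecidableEq V] {G : SimpleGraph V} [DecidableRel G.Adj] {c : ℝ}

/-! ### Balls and cutoff functions -/

variable (G) in
/-- The ball of radius `n` around `v`: the vertices that a walk of length at most `n` joins to
`v`. -/
def ball : ℕ → V → Finset V
  | 0, v => {v}
  | n + 1, v => (insert v (G.neighborFinset v)).biUnion (ball n)

theorem mem_ball_iff {n : ℕ} {u v : V} : u ∈ ball G n v ↔ ∃ p : G.Walk v u, p.length ≤ n := by
  induction n generalizing v with
  | zero =>
    simp only [ball, mem_singleton, Nat.le_zero]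
    constructor
    · rintro rfl; exact ⟨.nil, rfl⟩
    · rintro ⟨p, hp⟩; exact (SimpleGraph.Walk.eq_of_length_eq_zero hp).symm
  | succ n ih =>
    simp only [ball, mem_biUnion, mem_insert, SimpleGraph.mem_neighborFinset, ih]
    constructor
    · rintro ⟨w, rfl | hw, p, hp⟩
      · exact ⟨p, hp.trans (Nat.le_succ n)⟩
      · exact ⟨.cons hw p, by simpa using hp⟩
    · rintro ⟨p, hp⟩
      cases p with
      | nil => exact ⟨u, Or.inl rfl, .nil, by simp⟩
      | cons h p => exact ⟨_, Or.inr h, p, by simpa using hp⟩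

theorem mem_ball_self (n : ℕ) (v : V) : v ∈ ball G n v := mem_ball_iff.2 ⟨.nil, by simp⟩

theorem mem_ball_comm {n : ℕ} {u v : V} : u ∈ ball G n v ↔ v ∈ ball G n u := by
  rw [mem_ball_iff, mem_ball_iff]
  exact ⟨fun ⟨p, hp⟩ => ⟨p.reverse, by simpa using hp⟩, fun ⟨p, hp⟩ => ⟨p.reverse, by simpa using hp⟩⟩

theorem mem_ball_trans {m n : ℕ} {u v w : V} (h : v ∈ ball G m u) (h' : w ∈ ball G n v) :
    w ∈ ball G (m + n) u := by
  rw [mem_ball_iff] at *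
  obtain ⟨p, hp⟩ := h
  obtain ⟨q, hq⟩ := h'
  exact ⟨p.append q, by rw [SimpleGraph.Walk.length_append]; omega⟩

theorem ball_mono {m n : ℕ} (h : m ≤ n) (v : V) : ball G m v ⊆ ball G n v := fun u hu => by
  rw [mem_ball_iff] at *
  obtain ⟨p, hp⟩ := hu
  exact ⟨p, hp.trans h⟩

theorem mem_ball_of_adj {u v : V} (h : G.Adj v u) : u ∈ ball G 1 v :=
  mem_ball_iff.2 ⟨.cons h .nil, by simp⟩

theorem card_ball_le {D : ℝ} (hD : ∀ v, (G.degree v : ℝ) + 1 ≤ D) (n : ℕ) (v : V) :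
    ((ball G n v).card : ℝ) ≤ D ^ n := by
  induction n generalizing v with
  | zero => simp [ball]
  | succ n ih =>
    have hD0 : 0 ≤ D := le_trans (by positivity) (hD v)
    calc ((ball G (n + 1) v).card : ℝ)
        ≤ ∑ w ∈ insert v (G.neighborFinset v), ((ball G n w).card : ℝ) := by
          rw [ball]; exact_mod_cast card_biUnion_le
      _ ≤ ∑ w ∈ insert v (G.neighborFinset v), D ^ n := sum_le_sum fun w _ => ih w
      _ = ((insert v (G.neighborFinset v)).card : ℝ) * D ^ n := by rw [sum_const, nsmul_eq_mul]
      _ ≤ D * D ^ n := by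
          refine mul_le_mul_of_nonneg_right (le_trans ?_ (hD v)) (pow_nonneg hD0 n)
          have := card_insert_le v (G.neighborFinset v)
          rw [SimpleGraph.card_neighborFinset_eq_degree] at this
          exact_mod_cast this
      _ = D ^ (n + 1) := by ring

variable (G) in
/-- The cutoff function that is `1` on the ball of radius `R` around `v`, vanishes outside the ball
of radius `R + L`, and changes by at most `1 / L` along each edge. -/
noncomputable def cutoff (R L : ℕ) (v x : V) : ℝ :=
  (((range L).filter fun i => x ∈ ball G (R + i) v).card : ℝ) / L

theorem cutoff_eq_one {R L : ℕ} (hL : 0 < L) {v x : V} (h : x ∈ ball G R v) :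
    cutoff G R L v x = 1 := by
  unfold cutoff
  rw [filter_true_of_mem fun i _ => ball_mono (Nat.le_add_right R i) v h, card_range]
  exact div_self (by exact_mod_cast hL.ne')

theorem cutoff_eq_zero {R L : ℕ} {v x : V} (h : x ∉ ball G (R + L) v) :
    cutoff G R L v x = 0 := by
  unfold cutoff
  rw [filter_false_of_mem fun i hi hx =>
    h (ball_mono (Nat.add_le_add_left (mem_range.1 hi).le R) v hx)]
  simp

theorem cutoff_le_add {R L : ℕ} {v x y : V} (h : G.Adj x y) :
    cutoff G R L v x ≤ cutoff G R L v y + 1 / L := by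
  unfold cutoff
  rw [← add_div]
  refine div_le_div_of_nonneg_right ?_ (by positivity)
  have hs : ((range L).filter fun i => x ∈ ball G (R + i) v).image (· + 1) ⊆
      insert L ((range L).filter fun i => y ∈ ball G (R + i) v) := by
    intro j hj
    obtain ⟨i, hi, rfl⟩ := mem_image.1 hj
    rw [mem_filter, mem_range] at hi
    rw [mem_insert, mem_filter, mem_range]
    rcases (Nat.succ_le_of_lt hi.1).eq_or_lt with h' | h'
    · exact Or.inl h'
    · refine Or.inr ⟨h', ?_⟩
      rw [← add_assoc]
      exact mem_ball_trans hi.2 (mem_ball_of_adj h)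
  have := (card_le_card hs).trans (card_insert_le _ _)
  rw [card_image_of_injective _ (add_left_injective 1)] at this
  exact_mod_cast this

theorem sq_cutoff_sub_le {R L : ℕ} {v x y : V} (h : G.Adj x y) :
    (cutoff G R L v x - cutoff G R L v y) ^ 2 ≤ (1 / L) ^ 2 := by
  refine sq_le_sq' ?_ ?_
  · linarith [cutoff_le_add (R := R) (L := L) (v := v) h.symm]
  · linarith [cutoff_le_add (R := R) (L := L) (v := v) h]

/-- Localizing an eigenvector by a slowly varying cutoff makes the form almost degenerate. -/
theorem form_cutoff_le {R L : ℕ} {v : V} {y : V → ℝ}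
    (hy : ∀ u, ∑ w, G.adjMatrix ℝ u w * y w = c * y u) {Δ : ℝ}
    (hΔ : ∀ u, (G.degree u : ℝ) ≤ Δ) :
    form G c (fun x => cutoff G R L v x * y x) (fun x => cutoff G R L v x * y x) ≤
      Δ * (1 / L) ^ 2 / 2 * ∑ x, y x ^ 2 := by
  set χ := cutoff G R L v
  have h1 : c * ∑ u, χ u * y u * (χ u * y u) =
      ∑ u, ∑ w, G.adjMatrix ℝ u w * (χ u ^ 2 * (y u * y w)) := by
    rw [mul_sum]
    refine sum_congr rfl fun u _ => ?_
    calc c * (χ u * y u * (χ u * y u)) = χ u ^ 2 * y u * (c * y u) := by ring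
      _ = _ := by rw [← hy, mul_sum]; exact sum_congr rfl fun w _ => by ring
  have h2 : ∑ u, ∑ w, G.adjMatrix ℝ u w * (χ u ^ 2 * (y u * y w)) =
      ∑ u, ∑ w, G.adjMatrix ℝ u w * (χ w ^ 2 * (y u * y w)) := by
    rw [sum_comm]
    exact sum_congr rfl fun u _ => sum_congr rfl fun w _ => by rw [adj_symm]; ring
  have h3 : form G c (fun x => χ x * y x) (fun x => χ x * y x) =
      ∑ u, ∑ w, G.adjMatrix ℝ u w * ((χ u - χ w) ^ 2 * (y u * y w)) / 2 := by
    rw [form_eq, h1]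
    have h4 : ∑ u, ∑ w, G.adjMatrix ℝ u w * (χ u ^ 2 * (y u * y w)) =
        ∑ u, ∑ w, G.adjMatrix ℝ u w * ((χ u ^ 2 + χ w ^ 2) * (y u * y w)) / 2 := by
      calc _ = (∑ u, ∑ w, G.adjMatrix ℝ u w * (χ u ^ 2 * (y u * y w)) +
            ∑ u, ∑ w, G.adjMatrix ℝ u w * (χ w ^ 2 * (y u * y w))) / 2 := by rw [← h2]; ring
        _ = _ := by
            simp only [← sum_add_distrib, sum_div]
            exact sum_congr rfl fun u _ => sum_congr rfl fun w _ => by ring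
    rw [h4]
    simp only [← sum_sub_distrib]
    exact sum_congr rfl fun u _ => sum_congr rfl fun w _ => by ring
  rw [h3]
  have h5 : ∀ u w, G.adjMatrix ℝ u w * ((χ u - χ w) ^ 2 * (y u * y w)) / 2 ≤
      (1 / L) ^ 2 / 4 * (G.adjMatrix ℝ u w * y u ^ 2 + G.adjMatrix ℝ u w * y w ^ 2) := by
    intro u w
    by_cases h : G.Adj u w
    · simp only [SimpleGraph.adjMatrix_apply, h, if_true, one_mul]
      have h6 := sq_cutoff_sub_le (R := R) (L := L) (v := v) h
      have h7 : (χ u - χ w) ^ 2 * (y u * y w) ≤ (χ u - χ w) ^ 2 * ((y u ^ 2 + y w ^ 2) / 2) :=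
        mul_le_mul_of_nonneg_left (by nlinarith [sq_nonneg (y u - y w)]) (sq_nonneg _)
      have h8 := mul_le_mul_of_nonneg_right h6
        (show 0 ≤ (y u ^ 2 + y w ^ 2) / 2 by positivity)
      linarith
    · simp [SimpleGraph.adjMatrix_apply, h]
  have hdeg : ∀ u, ∑ w, G.adjMatrix ℝ u w = G.degree u := by
    intro u
    simp [SimpleGraph.adjMatrix_apply, ← SimpleGraph.card_neighborFinset_eq_degree,
      SimpleGraph.neighborFinset_eq_filter]
  have h9 : ∑ u, ∑ w, G.adjMatrix ℝ u w * y u ^ 2 ≤ Δ * ∑ u, y u ^ 2 := by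
    rw [mul_sum]
    refine sum_le_sum fun u _ => ?_
    rw [← sum_mul, hdeg]
    exact mul_le_mul_of_nonneg_right (hΔ u) (sq_nonneg _)
  have h10 : ∑ u, ∑ w, G.adjMatrix ℝ u w * y w ^ 2 = ∑ u, ∑ w, G.adjMatrix ℝ u w * y u ^ 2 := by
    rw [sum_comm]
    exact sum_congr rfl fun u _ => sum_congr rfl fun w _ => by rw [adj_symm]
  calc _ ≤ ∑ u, ∑ w, (1 / (L : ℝ)) ^ 2 / 4 *
        (G.adjMatrix ℝ u w * y u ^ 2 + G.adjMatrix ℝ u w * y w ^ 2) :=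
        sum_le_sum fun u _ => sum_le_sum fun w _ => h5 u w
    _ = (1 / (L : ℝ)) ^ 2 / 2 * ∑ u, ∑ w, G.adjMatrix ℝ u w * y u ^ 2 := by
        simp only [← mul_sum, sum_add_distrib]
        rw [h10]; ring
    _ ≤ (1 / (L : ℝ)) ^ 2 / 2 * (Δ * ∑ u, y u ^ 2) :=
        mul_le_mul_of_nonneg_left h9 (by positivity)
    _ = _ := by ring

/-! ### The projection onto a space of eigenvectors -/

/-- The matrix of the orthogonal projection onto the span of an orthonormal family `φ`. -/
def projKernel {I : Type*} [Fintype I] (φ : I → V → ℝ) (u v : V) : ℝ := ∑ i, φ i u * φ i v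

section projKernel

variable {I : Type*} [Fintype I] [DecidableEq I] {φ : I → V → ℝ}

theorem projKernel_comm (u v : V) : projKernel φ u v = projKernel φ v u :=
  sum_congr rfl fun _ _ => mul_comm _ _

theorem projKernel_self_nonneg (u : V) : 0 ≤ projKernel φ u u :=
  sum_nonneg fun _ _ => mul_self_nonneg _

theorem sq_projKernel_le (u v : V) :
    projKernel φ u v ^ 2 ≤ projKernel φ u u * projKernel φ v v := by
  have := sum_mul_sq_le_sq_mul_sq univ (fun i => φ i u) (fun i => φ i v)
  simpa only [projKernel, sq] using this

theorem projKernel_eigen (hφ : ∀ i u, ∑ v, G.adjMatrix ℝ u v * φ i v = c * φ i u) (w u : V) :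
    ∑ v, G.adjMatrix ℝ u v * projKernel φ w v = c * projKernel φ w u := by
  simp only [projKernel, mul_sum]
  rw [sum_comm]
  refine sum_congr rfl fun i _ => ?_
  calc _ = φ i w * ∑ v, G.adjMatrix ℝ u v * φ i v := by
        rw [mul_sum]; exact sum_congr rfl fun v _ => by ring
    _ = _ := by rw [hφ]; ring

theorem sum_sq_projKernel (ho : ∀ i j, ∑ u, φ i u * φ j u = if i = j then 1 else 0) (u : V) :
    ∑ v, projKernel φ u v ^ 2 = projKernel φ u u := by
  calc ∑ v, projKernel φ u v ^ 2 = ∑ v, ∑ i, ∑ j, φ i u * φ j u * (φ i v * φ j v) := by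
        refine sum_congr rfl fun v _ => ?_
        rw [projKernel, sq, sum_mul_sum]
        exact sum_congr rfl fun i _ => sum_congr rfl fun j _ => by ring
    _ = ∑ i, ∑ j, φ i u * φ j u * ∑ v, φ i v * φ j v := by
        rw [sum_comm]
        refine sum_congr rfl fun i _ => ?_
        rw [sum_comm]
        exact sum_congr rfl fun j _ => by rw [mul_sum]
    _ = projKernel φ u u := by
        simp only [ho, mul_ite, mul_one, mul_zero, sum_ite_eq, mem_univ, if_true, projKernel]

theorem sum_projKernel_self (ho : ∀ i j, ∑ u, φ i u * φ j u = if i = j then 1 else 0) :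
    ∑ u, projKernel φ u u = Fintype.card I := by
  unfold projKernel
  rw [sum_comm]
  simp [ho]

theorem projKernel_self_le_one (ho : ∀ i j, ∑ u, φ i u * φ j u = if i = j then 1 else 0) (u : V) :
    projKernel φ u u ≤ 1 := by
  have h1 : projKernel φ u u ^ 2 ≤ projKernel φ u u :=
    (single_le_sum (f := fun v => projKernel φ u v ^ 2) (fun v _ => sq_nonneg _)
      (mem_univ u)).trans (sum_sq_projKernel ho u).le
  nlinarith

end projKernel

end

section

variable {V : Type*} [Fintype V] [DecidableEq V] {G : SimpleGraph V} [DecidableRel G.Adj] {c : ℝ}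
  {I : Type*} [Fintype I] [DecidableEq I] {φ : I → V → ℝ}

/-! ### Rigidity of the projection along paths -/

variable (G) in
/-- The modulus of the normalized column of `s` of the projection, cut off around `v`. -/
noncomputable def column (φ : I → V → ℝ) (R L : ℕ) (v s x : V) : ℝ :=
  |cutoff G R L v x * (projKernel φ s x / √(projKernel φ s s))|

theorem form_column_le (ho : ∀ i j, ∑ u, φ i u * φ j u = if i = j then 1 else 0)
    (hφ : ∀ i u, ∑ v, G.adjMatrix ℝ u v * φ i v = c * φ i u) {Δ : ℝ}
    (hΔ : ∀ u, (G.degree u : ℝ) ≤ Δ) (R L : ℕ) (v : V) {s : V} (hs : 0 < projKernel φ s s) :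
    form G c (column G φ R L v s) (column G φ R L v s) ≤ Δ * (1 / L) ^ 2 / 2 := by
  refine (form_abs_le _).trans ((form_cutoff_le (y := fun x => projKernel φ s x /
    √(projKernel φ s s)) (fun u => ?_) hΔ).trans (le_of_eq ?_))
  · simp only [mul_div_assoc', ← sum_div]
    rw [projKernel_eigen hφ]
  · simp only [div_pow, ← sum_div, Real.sq_sqrt hs.le]
    rw [sum_sq_projKernel ho, div_self hs.ne', mul_one]

/-- Along a short path of vertices with large diagonal entries, the projection is almost of rank
one: its `2 × 2` principal minors almost vanish. -/
theorem projKernel_rigid (ho : ∀ i j, ∑ u, φ i u * φ j u = if i = j then 1 else 0)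
    (hφ : ∀ i u, ∑ v, G.adjMatrix ℝ u v * φ i v = c * φ i u) (hc : 0 < c) {Δ : ℝ}
    (hΔ : ∀ u, (G.degree u : ℝ) ≤ Δ) {R L : ℕ} (hL : 0 < L) {θ δ κ : ℝ} (hθ : 0 < θ) (hδ : δ < 1)
    (hκ : 0 ≤ κ) (hκε : c * (Δ * (1 / L) ^ 2 / 2) ≤ κ ^ 2) (hκσ : κ ≤ (1 - δ) * θ)
    (hR : R * (κ / ((1 - δ) * θ)) ≤ δ) (p : ℕ → V) (hpos : NonnegOn G c (ball G (R + L) (p 0)))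
    (n : ℕ) (hn : n ≤ R) (hp : ∀ j ≤ n, θ ^ 2 ≤ projKernel φ (p j) (p j))
    (hadj : ∀ j < n, G.Adj (p j) (p (j + 1))) :
    (1 - δ) * (√(projKernel φ (p 0) (p 0)) * √(projKernel φ (p n) (p n))) ≤
      |projKernel φ (p 0) (p n)| := by
  induction n using Nat.strong_induction_on with
  | _ n ih =>
  have hσ : 0 < (1 - δ) * θ := mul_pos (by linarith) hθ
  have hpp : ∀ j ≤ n, 0 < projKernel φ (p j) (p j) := fun j hj =>
    lt_of_lt_of_le (by positivity) (hp j hj)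
  have hball : ∀ j ≤ n, p j ∈ ball G j (p 0) := by
    intro j hj
    induction j with
    | zero => exact mem_ball_self _ _
    | succ j ihj => exact mem_ball_trans (ihj (by omega)) (mem_ball_of_adj (hadj j (by omega)))
  have hone : ∀ j ≤ n, cutoff G R L (p 0) (p j) = 1 := fun j hj =>
    cutoff_eq_one hL (ball_mono (by omega) _ (hball j hj))
  have hval : ∀ s, ∀ j ≤ n, column G φ R L (p 0) s (p j) =
      |projKernel φ s (p j)| / √(projKernel φ s s) := by
    intro s j hj
    rw [column, hone j hj, one_mul, abs_div, abs_of_nonneg (Real.sqrt_nonneg _)]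
  have hw : ∀ j ≤ n, θ ≤ √(projKernel φ (p j) (p j)) := fun j hj =>
    Real.le_sqrt_of_sq_le (hp j hj)
  set w₀ := √(projKernel φ (p 0) (p 0)) with hw0
  set wₙ := √(projKernel φ (p n) (p n)) with hwn
  have hw0p : 0 < w₀ := hθ.trans_le (hw 0 (Nat.zero_le n))
  have hwnp : 0 < wₙ := hθ.trans_le (hw n le_rfl)
  have hsq : ∀ j ≤ n, |projKernel φ (p j) (p j)| =
      √(projKernel φ (p j) (p j)) * √(projKernel φ (p j) (p j)) := fun j hj => by
    rw [abs_of_pos (hpp j hj), Real.mul_self_sqrt (hpp j hj).le]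
  have key := hpos.chain hc.le (f := column G φ R L (p 0) (p 0)) (g := column G φ R L (p 0) (p n))
    (fun _ => abs_nonneg _) (fun _ => abs_nonneg _)
    (fun u hu => by rw [column, cutoff_eq_zero hu]; simp)
    (fun u hu => by rw [column, cutoff_eq_zero hu]; simp) hκ hκε
    (form_column_le ho hφ hΔ R L _ (hpp 0 (Nat.zero_le n)))
    (form_column_le ho hφ hΔ R L _ (hpp n le_rfl)) hσ hκσ p n
    (fun j hj => ball_mono (by omega) _ (hball j hj)) hadj (by
      intro j hj
      have h1 := ih j hj (by omega) (fun i hi => hp i (by omega)) (fun i hi => hadj i (by omega))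
      rw [hval _ j hj.le, le_div_iff₀ hw0p]
      have h2 := mul_le_mul_of_nonneg_left (hw j hj.le)
        (mul_nonneg (by linarith : (0 : ℝ) ≤ 1 - δ) hw0p.le)
      linarith)
  rw [hval _ 0 (Nat.zero_le n), hval _ n le_rfl, hval _ 0 (Nat.zero_le n), hval _ n le_rfl,
    hsq 0 (Nat.zero_le n), hsq n le_rfl, ← hw0, ← hwn, projKernel_comm (p n) (p 0)] at key
  set P := |projKernel φ (p 0) (p n)| with hP
  have hP0 : 0 ≤ P := abs_nonneg _
  have hq : 1 - δ ≤ (1 - κ / ((1 - δ) * θ)) ^ n := by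
    have h1 := one_add_mul_le_pow (a := -(κ / ((1 - δ) * θ)))
      (by have : κ / ((1 - δ) * θ) ≤ 1 := (div_le_one hσ).2 hκσ
          linarith) n
    have h2 : (n : ℝ) * (κ / ((1 - δ) * θ)) ≤ R * (κ / ((1 - δ) * θ)) :=
      mul_le_mul_of_nonneg_right (by exact_mod_cast hn) (by positivity)
    rw [← sub_eq_add_neg] at h1
    linarith
  have hww : 0 < w₀ * wₙ := mul_pos hw0p hwnp
  have key2 : (P + w₀ * wₙ) * ((1 - κ / ((1 - δ) * θ)) ^ n * (w₀ * wₙ)) ≤ (P + w₀ * wₙ) * P := by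
    have := mul_le_mul_of_nonneg_right key hww.le
    have e1 : (P / w₀ + wₙ * wₙ / wₙ) * (w₀ * w₀ / w₀) * (1 - κ / ((1 - δ) * θ)) ^ n * (w₀ * wₙ) =
        (P + w₀ * wₙ) * ((1 - κ / ((1 - δ) * θ)) ^ n * (w₀ * wₙ)) := by field_simp
    have e2 : P / w₀ * (w₀ * w₀ / w₀ + P / wₙ) * (w₀ * wₙ) = (P + w₀ * wₙ) * P := by
      field_simp; ring
    rw [e1, e2] at this
    exact this
  exact (mul_le_mul_of_nonneg_right hq hww.le).trans
    (le_of_mul_le_mul_left key2 (by positivity))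

/-! ### Sums over a finite set of vertices -/

/-- A finite set with a neighbour outside it spans few edges, if the form is nonnegative around
it. -/
theorem NonnegOn.sum_adj_le {Ω B : Finset V} (h : NonnegOn G c Ω) (hc : 0 < c) (hB : B ⊆ Ω)
    {b w : V} (hw : w ∈ Ω) (hwB : w ∉ B) (hb : b ∈ B) (hbw : G.Adj b w) :
    ∑ u ∈ B, ∑ v ∈ B, G.adjMatrix ℝ u v ≤ c * B.card - 1 / c := by
  set x : V → ℝ := fun u => if u ∈ B then 1 else 0 with hx
  have h1 := h (fun u => 1 * x u + (1 / c) * (Pi.single w 1 : V → ℝ) u) fun u hu => by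
    have h2 : u ≠ w := by rintro rfl; exact hu hw
    have h3 : u ∉ B := fun h' => hu (hB h')
    simp [hx, h2, h3]
  rw [form_comb, form_single_single, form_comm x (Pi.single w 1), form_single_left] at h1
  have h2 : form G c x x = c * B.card - ∑ u ∈ B, ∑ v ∈ B, G.adjMatrix ℝ u v := by
    rw [form_eq]
    simp [hx]
  have h3 : 1 ≤ ∑ v, G.adjMatrix ℝ w v * x v := by
    have := single_le_sum (f := fun v => G.adjMatrix ℝ w v * x v) (s := univ)
      (fun v _ => mul_nonneg (adj_nonneg _ _) (by simp only [hx]; split_ifs <;> norm_num))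
      (mem_univ b)
    simpa [hx, hb, SimpleGraph.adjMatrix_apply, hbw.symm] using this
  have h4 : x w = 0 := by simp [hx, hwB]
  rw [h2, h4] at h1
  have h5 : 1 / c * (∑ v, G.adjMatrix ℝ w v * x v) ≥ 1 / c := by
    have := mul_le_mul_of_nonneg_left h3 (by positivity : 0 ≤ 1 / c)
    linarith
  have h6 : (1 / c) ^ 2 * c = 1 / c := by field_simp
  nlinarith

theorem NonnegOn.sum_adj_projKernel_le {Ω B : Finset V} (h : NonnegOn G c Ω) (hB : B ⊆ Ω) :
    ∑ u ∈ B, ∑ v ∈ B, G.adjMatrix ℝ u v * projKernel φ u v ≤ c * ∑ u ∈ B, projKernel φ u u := by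
  have h1 : ∀ i, 0 ≤ c * ∑ u ∈ B, φ i u * φ i u -
      ∑ u ∈ B, ∑ v ∈ B, G.adjMatrix ℝ u v * (φ i u * φ i v) := by
    intro i
    have h2 := h (fun u => if u ∈ B then φ i u else 0) fun u hu => by
      rw [if_neg fun h' => hu (hB h')]
    rw [form_eq] at h2
    simpa [sum_ite] using h2
  have h3 := sum_nonneg fun i (_ : i ∈ univ) => h1 i
  rw [sum_sub_distrib, ← mul_sum, sum_comm] at h3
  have h4 : ∑ i, ∑ u ∈ B, ∑ v ∈ B, G.adjMatrix ℝ u v * (φ i u * φ i v) =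
      ∑ u ∈ B, ∑ v ∈ B, G.adjMatrix ℝ u v * projKernel φ u v := by
    rw [sum_comm]
    refine sum_congr rfl fun u _ => ?_
    rw [sum_comm]
    exact sum_congr rfl fun v _ => by rw [projKernel, mul_sum]
  rw [h4] at h3
  simp only [projKernel] at h3 ⊢
  linarith

theorem card_mul_sq_sum_adj_projKernel_le (B : Finset V) :
    B.card * (∑ u ∈ B, ∑ v ∈ B, G.adjMatrix ℝ u v * projKernel φ u v) ^ 2 ≤
      (∑ u ∈ B, ∑ v ∈ B, G.adjMatrix ℝ u v) *
        ((B.card - 1) * (∑ u ∈ B, projKernel φ u u) ^ 2) := by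
  set T := ∑ u ∈ B, projKernel φ u u with hT
  have hA : ∀ u v, G.adjMatrix ℝ u v ^ 2 = G.adjMatrix ℝ u v := fun u v => by
    rw [SimpleGraph.adjMatrix_apply]; split_ifs <;> norm_num
  have hcs := sum_mul_sq_le_sq_mul_sq (B ×ˢ B) (fun p => G.adjMatrix ℝ p.1 p.2)
    (fun p => G.adjMatrix ℝ p.1 p.2 * projKernel φ p.1 p.2)
  simp only [sum_product, ← mul_assoc, ← sq, hA] at hcs
  have h1 : ∑ u ∈ B, ∑ v ∈ B, (G.adjMatrix ℝ u v * projKernel φ u v) ^ 2 ≤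
      T ^ 2 - ∑ u ∈ B, projKernel φ u u ^ 2 := by
    have : T ^ 2 - ∑ u ∈ B, projKernel φ u u ^ 2 = ∑ u ∈ B, ∑ v ∈ B,
        (projKernel φ u u * projKernel φ v v - if u = v then projKernel φ u u ^ 2 else 0) := by
      simp only [sum_sub_distrib, sum_ite_eq, ← sum_mul_sum]
      rw [hT, sq]
      congr 1
      exact sum_congr rfl fun u hu => by rw [if_pos hu]
    rw [this]
    refine sum_le_sum fun u _ => sum_le_sum fun v _ => ?_
    rw [mul_pow, hA]
    by_cases huv : u = v
    · subst huv
      rw [if_pos rfl, sq (projKernel φ u u), sub_self]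
      simp [SimpleGraph.adjMatrix_apply]
    · rw [if_neg huv, sub_zero]
      refine le_trans (mul_le_of_le_one_left (sq_nonneg _) ?_) (sq_projKernel_le u v)
      rw [SimpleGraph.adjMatrix_apply]; split_ifs <;> norm_num
  have h2 : T ^ 2 ≤ B.card * ∑ u ∈ B, projKernel φ u u ^ 2 := sq_sum_le_card_mul_sum_sq
  have hE : 0 ≤ ∑ u ∈ B, ∑ v ∈ B, G.adjMatrix ℝ u v :=
    sum_nonneg fun u _ => sum_nonneg fun v _ => adj_nonneg _ _
  have hb : (0 : ℝ) ≤ B.card := by positivity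
  have h3 := mul_le_mul_of_nonneg_left (hcs.trans (mul_le_mul_of_nonneg_left h1 hE)) hb
  have h4 := mul_le_mul_of_nonneg_left h2 hE
  nlinarith

end

section

variable {V : Type*} [Fintype V] [DecidableEq V] {G : SimpleGraph V} [DecidableRel G.Adj] {c : ℝ}
  {I : Type*} [Fintype I] [DecidableEq I] {φ : I → V → ℝ}

/-! ### Blocks of vertices with large diagonal entries -/

variable (G) in
/-- The graph with the edges of `G` that have both ends in `U`. -/
def restrict (U : Finset V) : SimpleGraph V where
  Adj u v := G.Adj u v ∧ u ∈ U ∧ v ∈ U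
  symm := ⟨fun _ _ h => ⟨h.1.symm, h.2.2, h.2.1⟩⟩
  loopless := ⟨fun _ h => h.1.ne rfl⟩

/-- The situation in which the projection is analysed: `φ` is an orthonormal family of
eigenvectors of `G` for the eigenvalue `c`, the balls of radius `R + L` around the vertices of `U`
have spectral radius at most `c`, and the diagonal entries of the projection are at least `θ ^ 2`
on `U`. The numbers `R` (length of paths), `L` (width of the cutoff), `κ` (error in the eigenvector
equation) and `δ` (relative error in rank one) are related such that errors do not accumulate along
paths of length `R`, while all paths of large vertices are shorter than `R`. -/
structure Admissible (G : SimpleGraph V) [DecidableRel G.Adj] (c : ℝ) (φ : I → V → ℝ)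
    (Δ θ δ κ : ℝ) (R L : ℕ) (U : Finset V) : Prop where
  orthonormal : ∀ i j, ∑ u, φ i u * φ j u = if i = j then 1 else 0
  eigen : ∀ i u, ∑ v, G.adjMatrix ℝ u v * φ i v = c * φ i u
  c_pos : 0 < c
  degree_le : ∀ u, (G.degree u : ℝ) ≤ Δ
  L_pos : 0 < L
  θ_pos : 0 < θ
  δ_lt_one : δ < 1
  κ_nonneg : 0 ≤ κ
  κ_sq : c * (Δ * (1 / L) ^ 2 / 2) ≤ κ ^ 2
  κ_le : κ ≤ (1 - δ) * θ
  R_le : R * (κ / ((1 - δ) * θ)) ≤ δ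
  le_R : 1 ≤ R * ((1 - δ) * θ) ^ 2
  nonneg_ball : ∀ v ∈ U, NonnegOn G c (ball G (R + L) v)
  large : ∀ v ∈ U, θ ^ 2 ≤ projKernel φ v v

namespace Admissible

variable {Δ θ δ κ : ℝ} {R L : ℕ} {U : Finset V}

theorem getVert_mem {v u : V} (hv : v ∈ U) (p : (restrict G U).Walk v u) {i : ℕ}
    (hi : i ≤ p.length) : p.getVert i ∈ U := by
  cases i with
  | zero => simpa using hv
  | succ i => exact (p.adj_getVert_succ (Nat.lt_of_succ_le hi)).2.2

theorem rigid (a : Admissible G c φ Δ θ δ κ R L U) {v u : V} (hv : v ∈ U)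
    (p : (restrict G U).Walk v u) {n : ℕ} (hn : n ≤ R) (hnp : n ≤ p.length) :
    (1 - δ) ^ 2 * (projKernel φ v v * projKernel φ (p.getVert n) (p.getVert n)) ≤
      projKernel φ v (p.getVert n) ^ 2 := by
  have h := projKernel_rigid a.orthonormal a.eigen a.c_pos a.degree_le a.L_pos a.θ_pos a.δ_lt_one
    a.κ_nonneg a.κ_sq a.κ_le a.R_le p.getVert (by simpa using a.nonneg_ball v hv) n hn
    (fun j hj => a.large _ (getVert_mem hv p (hj.trans hnp)))
    (fun j hj => (p.adj_getVert_succ (hj.trans_le hnp)).1)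
  rw [p.getVert_zero, ← Real.sqrt_mul (projKernel_self_nonneg _)] at h
  have h0 : 0 ≤ 1 - δ := by linarith [a.δ_lt_one]
  have h1 := pow_le_pow_left₀ (mul_nonneg h0 (Real.sqrt_nonneg _)) h 2
  rwa [mul_pow, Real.sq_sqrt (mul_nonneg (projKernel_self_nonneg _) (projKernel_self_nonneg _)),
    sq_abs] at h1

theorem length_le (a : Admissible G c φ Δ θ δ κ R L U) {v u : V} (hv : v ∈ U)
    (p : (restrict G U).Walk v u) (hp : p.IsPath) : p.length ≤ R := by
  by_contra! hlt
  have hpos : 0 < projKernel φ v v := lt_of_lt_of_le (by have := a.θ_pos; positivity) (a.large v hv)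
  have hinj : Set.InjOn p.getVert (range (R + 1) : Finset ℕ) := by
    refine hp.getVert_injOn.mono fun i hi => ?_
    have : i < R + 1 := by simpa using hi
    show i ≤ p.length
    omega
  have h1 : ∑ i ∈ range (R + 1), ((1 - δ) * θ) ^ 2 * projKernel φ v v ≤ projKernel φ v v := by
    calc _ ≤ ∑ i ∈ range (R + 1), projKernel φ v (p.getVert i) ^ 2 := by
          refine sum_le_sum fun i hi => ?_
          have hi' : i ≤ R := Nat.lt_succ_iff.1 (mem_range.1 hi)
          refine le_trans ?_ (a.rigid hv p hi' (by omega))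
          have h2 := mul_le_mul_of_nonneg_left (a.large _ (getVert_mem hv p (i := i) (by omega)))
            (mul_nonneg (sq_nonneg (1 - δ)) hpos.le)
          nlinarith
      _ = ∑ x ∈ (range (R + 1)).image p.getVert, projKernel φ v x ^ 2 := by
          rw [sum_image hinj]
      _ ≤ ∑ x, projKernel φ v x ^ 2 :=
          sum_le_sum_of_subset_of_nonneg (subset_univ _) fun _ _ _ => sq_nonneg _
      _ = projKernel φ v v := sum_sq_projKernel a.orthonormal v
  rw [sum_const, card_range, nsmul_eq_mul] at h1
  have h3 := a.le_R
  have hσ : 0 < ((1 - δ) * θ) ^ 2 :=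
    pow_pos (mul_pos (by linarith [a.δ_lt_one]) a.θ_pos) 2
  push_cast at h1
  have h4 : 1 * projKernel φ v v < ((R : ℝ) + 1) * ((1 - δ) * θ) ^ 2 * projKernel φ v v :=
    mul_lt_mul_of_pos_right (by linarith) hpos
  linarith

theorem reachable (a : Admissible G c φ Δ θ δ κ R L U) {v u : V} (hv : v ∈ U)
    (h : (restrict G U).Reachable v u) : u ∈ U ∧ u ∈ ball G R v ∧
      (1 - δ) ^ 2 * (projKernel φ v v * projKernel φ u u) ≤ projKernel φ v u ^ 2 := by
  obtain ⟨p⟩ := h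
  have hlen := a.length_le hv p.toPath.1 p.toPath.2
  refine ⟨?_, ?_, ?_⟩
  · simpa using getVert_mem hv p.toPath.1 (le_refl _)
  · rw [mem_ball_iff]
    refine ⟨p.toPath.1.mapLe (fun u w (h : (restrict G U).Adj u w) => h.1), ?_⟩
    simpa using hlen
  · simpa using a.rigid hv p.toPath.1 hlen le_rfl

open Classical in
/-- The block of `v`: the vertices that paths inside `U` join to `v`. -/
noncomputable def block (G : SimpleGraph V) (U : Finset V) (v : V) : Finset V :=
  univ.filter fun u => (restrict G U).Reachable v u

theorem mem_block {v u : V} : u ∈ block G U v ↔ (restrict G U).Reachable v u := by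
  simp [block]

theorem mem_block_self (v : V) : v ∈ block G U v := mem_block.2 (.refl _)

theorem block_subset_ball (a : Admissible G c φ Δ θ δ κ R L U) {v : V} (hv : v ∈ U) :
    block G U v ⊆ ball G R v := fun _ hu => (a.reachable hv (mem_block.1 hu)).2.1

theorem block_subset (a : Admissible G c φ Δ θ δ κ R L U) {v : V} (hv : v ∈ U) :
    block G U v ⊆ U := fun _ hu => (a.reachable hv (mem_block.1 hu)).1

theorem mem_block_of_adj (a : Admissible G c φ Δ θ δ κ R L U) {v u w : V} (hv : v ∈ U)
    (hu : u ∈ block G U v) (hw : w ∈ U) (h : G.Adj u w) : w ∈ block G U v :=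
  mem_block.2 ((mem_block.1 hu).trans
    (SimpleGraph.Adj.reachable (G := restrict G U) ⟨h, a.block_subset hv hu, hw⟩))

theorem sum_block_le (a : Admissible G c φ Δ θ δ κ R L U) {v : V} (hv : v ∈ U) :
    ∑ u ∈ block G U v, projKernel φ u u ≤ 1 / (1 - δ) ^ 2 := by
  have hpos : 0 < projKernel φ v v := lt_of_lt_of_le (by have := a.θ_pos; positivity) (a.large v hv)
  have hδ : 0 < (1 - δ) ^ 2 := pow_pos (by linarith [a.δ_lt_one]) 2
  rw [le_div_iff₀ hδ]
  refine le_of_mul_le_mul_left ?_ hpos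
  calc projKernel φ v v * ((∑ u ∈ block G U v, projKernel φ u u) * (1 - δ) ^ 2)
      = ∑ u ∈ block G U v, (1 - δ) ^ 2 * (projKernel φ v v * projKernel φ u u) := by
        rw [sum_mul, mul_sum]; exact sum_congr rfl fun u _ => by ring
    _ ≤ ∑ u ∈ block G U v, projKernel φ v u ^ 2 :=
        sum_le_sum fun u hu => (a.reachable hv (mem_block.1 hu)).2.2
    _ ≤ ∑ u, projKernel φ v u ^ 2 :=
        sum_le_sum_of_subset_of_nonneg (subset_univ _) fun _ _ _ => sq_nonneg _
    _ = projKernel φ v v * 1 := by rw [sum_sq_projKernel a.orthonormal, mul_one]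

end Admissible

theorem form_eq_zero_of_separated {x y : V → ℝ}
    (h : ∀ u v, x u ≠ 0 → y v ≠ 0 → u ≠ v ∧ ¬G.Adj u v) : form G c x y = 0 := by
  rw [form_eq]
  have h1 : ∀ u, x u * y u = 0 := fun u => by
    by_contra h'
    exact (h u u (left_ne_zero_of_mul h') (right_ne_zero_of_mul h')).1 rfl
  have h2 : ∀ u v, G.adjMatrix ℝ u v * (x u * y v) = 0 := fun u v => by
    by_contra h'
    have h3 := right_ne_zero_of_mul h'
    refine (h u v (left_ne_zero_of_mul h3) (right_ne_zero_of_mul h3)).2 ?_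
    by_contra h4
    exact left_ne_zero_of_mul h' (by simp [SimpleGraph.adjMatrix_apply, h4])
  simp only [h1, h2, sum_const_zero, mul_zero, sub_zero]

namespace Admissible

variable {Δ θ δ κ : ℝ} {R L : ℕ} {U : Finset V}

/-- No block is a union of connected components of `G`: on such a block, the modulus of a column of
the projection would be a null vector, to be combined with a negative vector elsewhere. -/
theorem exists_adj_block (a : Admissible G c φ Δ θ δ κ R L U)
    (H : ∀ x : V → ℝ, ∑ u, x u = 0 → 0 ≤ form G c x x) (hneg : ∃ x : V → ℝ, form G c x x < 0)
    {v : V} (hv : v ∈ U) : ∃ b ∈ block G U v, ∃ w ∉ block G U v, G.Adj b w := by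
  by_contra! hcl
  have hcl' : ∀ u ∈ block G U v, ∀ w, G.Adj u w → w ∈ block G U v := fun u hu w h => by
    by_contra h'
    exact hcl u hu w h' h
  set B := block G U v with hB
  have hpos : 0 < projKernel φ v v := lt_of_lt_of_le (by have := a.θ_pos; positivity) (a.large v hv)
  have hBΩ : B ⊆ ball G (R + L) v :=
    (a.block_subset_ball hv).trans (ball_mono (Nat.le_add_right R L) v)
  set y : V → ℝ := fun u => if u ∈ B then projKernel φ v u else 0 with hy
  have hyy : form G c y y = 0 := by
    rw [form_eq_sum_mul]
    refine sum_eq_zero fun u _ => ?_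
    by_cases hu : u ∈ B
    · have : ∑ w, G.adjMatrix ℝ u w * y w = ∑ w, G.adjMatrix ℝ u w * projKernel φ v w := by
        refine sum_congr rfl fun w _ => ?_
        by_cases huw : G.Adj u w
        · simp only [hy, if_pos (hcl' u hu w huw)]
        · simp [SimpleGraph.adjMatrix_apply, huw]
      rw [this, projKernel_eigen a.eigen]
      simp [hy, hu]
    · simp [hy, hu]
  obtain ⟨x, hx⟩ := hneg
  have hx1 := (form_abs_le x).trans_lt hx
  set x₁ : V → ℝ := fun u => if u ∈ B then |x u| else 0 with hx₁
  set x₂ : V → ℝ := fun u => if u ∈ B then 0 else |x u| with hx₂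
  have hsplit : (fun u => |x u|) = fun u => 1 * x₁ u + 1 * x₂ u := by
    funext u
    by_cases hu : u ∈ B <;> simp [hx₁, hx₂, hu]
  have h12 : form G c x₁ x₂ = 0 := form_eq_zero_of_separated fun u w hu hw => by
    have hu' : u ∈ B := by by_contra h'; simp [hx₁, h'] at hu
    have hw' : w ∉ B := by intro h'; simp [hx₂, h'] at hw
    exact ⟨fun h => hw' (h ▸ hu'), fun h => hw' (hcl' u hu' w h)⟩
  have h11 : 0 ≤ form G c x₁ x₁ := a.nonneg_ball v hv x₁ fun u hu => by
    simp only [hx₁, if_neg fun h => hu (hBΩ h)]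
  rw [hsplit, form_comb, h12] at hx1
  refine false_of_separated H (x := x₂) (y := fun u => |y u|) (fun u => abs_nonneg _)
    (by linarith) ((form_abs_le y).trans hyy.le) ⟨v, ?_⟩ ?_
  · have : v ∈ B := mem_block_self v
    simp [hy, this, hpos.ne']
  · rw [form_comm]
    refine form_eq_zero_of_separated fun u w hu hw => ?_
    have hu' : u ∈ B := by by_contra h'; simp [hy, h'] at hu
    have hw' : w ∉ B := by intro h'; simp [hx₂, h'] at hw
    exact ⟨fun h => hw' (h ▸ hu'), fun h => hw' (hcl' u hu' w h)⟩

/-- The mass of a block is at most about its number of vertices divided by `c + 1 + s`, up to the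
defect of the eigenvector equation inside the block. Namely, if the defect is small, the block has
at least `c + 1 + s` vertices, since otherwise it would span too few edges for the eigenvalue `c`. -/
theorem sum_block_le_card (a : Admissible G c φ Δ θ δ κ R L U)
    (H : ∀ x : V → ℝ, ∑ u, x u = 0 → 0 ≤ form G c x x) (hneg : ∃ x : V → ℝ, form G c x x < 0)
    {s γ : ℝ} (hs : 0 ≤ s) (hγ : 0 < γ) (hγc : γ ≤ c) (hsγ : s + 2 * γ ≤ 1 / (c * (c + 1)))
    {v : V} (hv : v ∈ U) :
    ∑ u ∈ block G U v, projKernel φ u u ≤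
      (block G U v).card / ((1 - δ) ^ 2 * (c + 1 + s)) +
        (c * ∑ u ∈ block G U v, projKernel φ u u -
          ∑ u ∈ block G U v, ∑ w ∈ block G U v, G.adjMatrix ℝ u w * projKernel φ u w) / γ := by
  have hc := a.c_pos
  obtain ⟨b, hb, w, hw, hbw⟩ := a.exists_adj_block H hneg hv
  have hBR := a.block_subset_ball hv
  have hΩ := a.nonneg_ball v hv
  have hBΩ : block G U v ⊆ ball G (R + L) v := hBR.trans (ball_mono (Nat.le_add_right R L) v)
  have hwΩ : w ∈ ball G (R + L) v :=
    ball_mono (Nat.add_le_add_left a.L_pos R) v (mem_ball_trans (hBR hb) (mem_ball_of_adj hbw))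
  have hE := hΩ.sum_adj_le hc hBΩ hwΩ hw hb hbw
  have hX := hΩ.sum_adj_projKernel_le (φ := φ) hBΩ
  have hXE := card_mul_sq_sum_adj_projKernel_le (G := G) (φ := φ) (block G U v)
  have hτ := a.sum_block_le hv
  have hE0 : 0 ≤ ∑ u ∈ block G U v, ∑ v ∈ block G U v, G.adjMatrix ℝ u v :=
    sum_nonneg fun u _ => sum_nonneg fun v _ => adj_nonneg _ _
  have hτ0 : 0 < ∑ u ∈ block G U v, projKernel φ u u :=
    lt_of_lt_of_le (lt_of_lt_of_le (by have := a.θ_pos; positivity) (a.large v hv))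
      (single_le_sum (f := fun u => projKernel φ u u) (fun u _ => projKernel_self_nonneg u)
        (mem_block_self v))
  have hb1 : (1 : ℝ) ≤ (block G U v).card := by
    exact_mod_cast card_pos.2 ⟨v, mem_block_self v⟩
  set n : ℝ := ((block G U v).card : ℝ)
  set τ := ∑ u ∈ block G U v, projKernel φ u u
  set X := ∑ u ∈ block G U v, ∑ w ∈ block G U v, G.adjMatrix ℝ u w * projKernel φ u w
  set E := ∑ u ∈ block G U v, ∑ v ∈ block G U v, G.adjMatrix ℝ u v
  have hδ : 0 < (1 - δ) ^ 2 := pow_pos (by linarith [a.δ_lt_one]) 2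
  have hcs : 0 < c + 1 + s := by linarith
  rcases le_or_gt X ((c - γ) * τ) with h | h
  · have h1 : τ ≤ (c * τ - X) / γ := by rw [le_div_iff₀ hγ]; linarith
    have h2 : 0 ≤ n / ((1 - δ) ^ 2 * (c + 1 + s)) := by positivity
    linarith
  · have h1 : 0 ≤ (c * τ - X) / γ := div_nonneg (by linarith) hγ.le
    suffices hn : c + 1 + s ≤ n by
      have h2 : 1 / (1 - δ) ^ 2 ≤ n / ((1 - δ) ^ 2 * (c + 1 + s)) := by
        rw [div_le_div_iff₀ hδ (by positivity)]
        nlinarith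
      linarith
    by_contra! hn
    have h2 : ((c - γ) * τ) ^ 2 ≤ X ^ 2 :=
      pow_le_pow_left₀ (mul_nonneg (by linarith) hτ0.le) h.le 2
    have h3 : n * (c - γ) ^ 2 ≤ (c * n - 1 / c) * (n - 1) := by
      refine le_of_mul_le_mul_right ?_ (pow_pos hτ0 2)
      have h4 := mul_le_mul_of_nonneg_left h2 (by linarith : 0 ≤ n)
      have h5 := mul_le_mul_of_nonneg_right hE
        (mul_nonneg (by linarith : 0 ≤ n - 1) (sq_nonneg τ))
      nlinarith
    have h6 : 0 ≤ c * n - 1 / c := hE0.trans hE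
    have h7 : (c * n - 1 / c) * (n - 1) ≤ (c * n - 1 / c) * (c + s) :=
      mul_le_mul_of_nonneg_left (by linarith) h6
    have h8 : c * n * (s + 2 * γ) ≤ c * n * (1 / (c * (c + 1))) :=
      mul_le_mul_of_nonneg_left hsγ (by positivity)
    have h9 : c * n * (1 / (c * (c + 1))) = n / (c + 1) := by field_simp
    have h10 : n / (c + 1) < (c + 1 + s) / (c + 1) :=
      div_lt_div_of_pos_right hn (by linarith)
    have h11 : (c + 1 + s) / (c + 1) ≤ (c + s) / c := by
      rw [div_le_div_iff₀ (by linarith) hc]; nlinarith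
    have h12 : 1 / c * (c + s) = (c + s) / c := by ring
    have h13 : 0 ≤ n * γ ^ 2 := by positivity
    nlinarith

theorem sum_le_sum_compl (a : Admissible G c φ Δ θ δ κ R L U) :
    ∑ u ∈ U, (c * projKernel φ u u - ∑ w ∈ U, G.adjMatrix ℝ u w * projKernel φ u w) ≤
      (c + Δ) * ∑ u ∈ Uᶜ, projKernel φ u u := by
  have hsplit : ∀ u, c * projKernel φ u u - ∑ w ∈ U, G.adjMatrix ℝ u w * projKernel φ u w =
      ∑ w ∈ Uᶜ, G.adjMatrix ℝ u w * projKernel φ u w := fun u => by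
    rw [← projKernel_eigen a.eigen, ← sum_add_sum_compl U]; ring
  have hdeg : ∀ u, ∑ w ∈ Uᶜ, G.adjMatrix ℝ u w ≤ Δ := by
    intro u
    refine le_trans ?_ (a.degree_le u)
    calc ∑ w ∈ Uᶜ, G.adjMatrix ℝ u w ≤ ∑ w, G.adjMatrix ℝ u w :=
          sum_le_sum_of_subset_of_nonneg (subset_univ _) fun _ _ _ => adj_nonneg _ _
      _ = G.degree u := by
          simp [SimpleGraph.adjMatrix_apply, ← SimpleGraph.card_neighborFinset_eq_degree,
            SimpleGraph.neighborFinset_eq_filter]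
  calc ∑ u ∈ U, (c * projKernel φ u u - ∑ w ∈ U, G.adjMatrix ℝ u w * projKernel φ u w)
      = ∑ u ∈ U, ∑ w ∈ Uᶜ, G.adjMatrix ℝ u w * projKernel φ u w :=
        sum_congr rfl fun u _ => hsplit u
    _ = ∑ w ∈ Uᶜ, ∑ u ∈ U, G.adjMatrix ℝ w u * projKernel φ w u := by
        rw [sum_comm]
        exact sum_congr rfl fun w _ => sum_congr rfl fun u _ => by
          rw [adj_symm, projKernel_comm]
    _ = ∑ w ∈ Uᶜ, (c * projKernel φ w w -
          ∑ u ∈ Uᶜ, G.adjMatrix ℝ w u * projKernel φ w u) :=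
        sum_congr rfl fun w _ => by rw [← hsplit w]; ring
    _ ≤ ∑ w ∈ Uᶜ, (c * projKernel φ w w + ∑ u ∈ Uᶜ, (G.adjMatrix ℝ w u * projKernel φ w w / 2 +
          G.adjMatrix ℝ w u * projKernel φ u u / 2)) := by
        refine sum_le_sum fun w _ => ?_
        rw [sub_eq_add_neg, ← sum_neg_distrib]
        refine add_le_add le_rfl (sum_le_sum fun u _ => ?_)
        have h1 : -projKernel φ w u ≤ (projKernel φ w w + projKernel φ u u) / 2 := by
          have h2 := sq_projKernel_le (φ := φ) w u
          have h3 := projKernel_self_nonneg (φ := φ) w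
          have h4 := projKernel_self_nonneg (φ := φ) u
          refine (neg_le_abs _).trans (abs_le_of_sq_le_sq ?_ (by linarith))
          nlinarith [sq_nonneg (projKernel φ w w - projKernel φ u u)]
        have := mul_le_mul_of_nonneg_left h1 (adj_nonneg (G := G) w u)
        linarith
    _ = ∑ w ∈ Uᶜ, (c * projKernel φ w w + (∑ u ∈ Uᶜ, G.adjMatrix ℝ w u) * projKernel φ w w) := by
        rw [sum_add_distrib, sum_add_distrib]
        congr 1
        simp only [sum_add_distrib]
        rw [sum_comm (f := fun w u => G.adjMatrix ℝ w u * projKernel φ u u / 2),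
          ← sum_add_distrib]
        refine sum_congr rfl fun w _ => ?_
        rw [sum_mul, ← sum_add_distrib]
        exact sum_congr rfl fun u _ => by rw [adj_symm u w]; ring
    _ ≤ ∑ w ∈ Uᶜ, (c * projKernel φ w w + Δ * projKernel φ w w) :=
        sum_le_sum fun w _ => add_le_add le_rfl
          (mul_le_mul_of_nonneg_right (hdeg w) (projKernel_self_nonneg w))
    _ = (c + Δ) * ∑ u ∈ Uᶜ, projKernel φ u u := by
        rw [mul_sum]; exact sum_congr rfl fun w _ => by ring

/-- The number of eigenvectors is bounded by the number of blocks, up to the mass outside `U`. -/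
theorem card_le (a : Admissible G c φ Δ θ δ κ R L U)
    (H : ∀ x : V → ℝ, ∑ u, x u = 0 → 0 ≤ form G c x x) (hneg : ∃ x : V → ℝ, form G c x x < 0)
    {s γ : ℝ} (hs : 0 ≤ s) (hγ : 0 < γ) (hγc : γ ≤ c) (hsγ : s + 2 * γ ≤ 1 / (c * (c + 1))) :
    (Fintype.card I : ℝ) ≤ Fintype.card V / ((1 - δ) ^ 2 * (c + 1 + s)) +
      (1 + (c + Δ) / γ) * ∑ u ∈ Uᶜ, projKernel φ u u := by
  classical
  have hc := a.c_pos
  have hδ : 0 < (1 - δ) ^ 2 := pow_pos (by linarith [a.δ_lt_one]) 2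
  set P : ℝ := 1 / ((1 - δ) ^ 2 * (c + 1 + s)) with hP
  have hP0 : 0 ≤ P := by positivity
  set F : V → ℝ := fun u => P + (c * projKernel φ u u -
    ∑ w ∈ U, G.adjMatrix ℝ u w * projKernel φ u w) / γ with hF
  have hblock : ∀ v ∈ U, ∑ u ∈ block G U v, projKernel φ u u ≤ ∑ u ∈ block G U v, F u := by
    intro v hv
    refine (a.sum_block_le_card H hneg hs hγ hγc hsγ hv).trans (le_of_eq ?_)
    simp only [hF, sum_add_distrib, ← sum_div, sum_sub_distrib, sum_const, nsmul_eq_mul]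
    congr 1
    · rw [hP]; ring
    · rw [mul_sum]
      congr 2
      refine sum_congr rfl fun u hu => sum_subset (a.block_subset hv) fun w hw hw' => ?_
      have : ¬G.Adj u w := fun h => hw' (a.mem_block_of_adj hv hu hw h)
      simp [SimpleGraph.adjMatrix_apply, this]
  have hU : ∑ u ∈ U, projKernel φ u u ≤ ∑ u ∈ U, F u := by
    have hmaps : ∀ u ∈ U, (restrict G U).connectedComponentMk u ∈
        U.image (restrict G U).connectedComponentMk := fun u hu => mem_image_of_mem _ hu
    rw [← sum_fiberwise_of_maps_to hmaps, ← sum_fiberwise_of_maps_to hmaps]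
    refine sum_le_sum fun k hk => ?_
    obtain ⟨v, hv, rfl⟩ := mem_image.1 hk
    have : (U.filter fun u => (restrict G U).connectedComponentMk u =
        (restrict G U).connectedComponentMk v) = block G U v := by
      ext u
      rw [mem_filter, mem_block, SimpleGraph.ConnectedComponent.eq]
      exact ⟨fun h => h.2.symm, fun h => ⟨(a.reachable hv h).1, h.symm⟩⟩
    rw [this]
    exact hblock v hv
  have hFsum : ∑ u ∈ U, F u ≤ P * Fintype.card V +
      (c + Δ) / γ * ∑ u ∈ Uᶜ, projKernel φ u u := by
    simp only [hF, sum_add_distrib, ← sum_div, sum_const, nsmul_eq_mul]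
    refine add_le_add ?_ ?_
    · rw [mul_comm]
      exact mul_le_mul_of_nonneg_left (by exact_mod_cast card_le_univ U) hP0
    · rw [div_mul_eq_mul_div]
      exact div_le_div_of_nonneg_right a.sum_le_sum_compl hγ.le
  rw [← sum_projKernel_self a.orthonormal, ← sum_add_sum_compl U]
  have hPV : P * Fintype.card V = Fintype.card V / ((1 - δ) ^ 2 * (c + 1 + s)) := by
    rw [hP]; ring
  linarith

end Admissible

end

section

variable {V : Type*} [Fintype V] [DecidableEq V] {G : SimpleGraph V} [DecidableRel G.Adj] {c : ℝ}
  {I : Type*} [Fintype I] [DecidableEq I] {φ : I → V → ℝ}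

/-! ### Balls of large spectral radius -/

/-- Balls of spectral radius larger than `c` meet or touch each other, hence their centres all lie
in one ball. -/
theorem card_not_nonnegOn_le (H : ∀ x : V → ℝ, ∑ u, x u = 0 → 0 ≤ form G c x x) {D : ℝ}
    (hD0 : 0 ≤ D) (hD : ∀ v, (G.degree v : ℝ) + 1 ≤ D) (k : ℕ) (K : Finset V)
    (hK : ∀ v ∈ K, ¬NonnegOn G c (ball G k v)) : (K.card : ℝ) ≤ D ^ (2 * k + 1) := by
  rcases K.eq_empty_or_nonempty with rfl | ⟨v₀, hv₀⟩
  · simpa using pow_nonneg hD0 _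
  refine le_trans ?_ (card_ball_le hD (2 * k + 1) v₀)
  refine Nat.cast_le.2 (card_le_card fun v hv => ?_)
  by_contra hfar
  have h0 := hK v₀ hv₀
  have h1 := hK v hv
  unfold NonnegOn at h0 h1
  push Not at h0 h1
  obtain ⟨x, hx, hxx⟩ := h0
  obtain ⟨y, hy, hyy⟩ := h1
  have hyy' := (form_abs_le y).trans_lt hyy
  refine false_of_separated H (x := fun u => |x u|) (y := fun u => |y u|) (fun u => abs_nonneg _)
    ((form_abs_le x).trans_lt hxx) hyy'.le ?_ (form_eq_zero_of_separated fun u w hu hw => ?_)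
  · by_contra! h
    rw [form_eq_sum_mul] at hyy'
    simp [h] at hyy'
  · have hu' : u ∈ ball G k v₀ := by by_contra h; simp [hx u h] at hu
    have hw' : w ∈ ball G k v := by by_contra h; simp [hy w h] at hw
    have hcon : w ∉ ball G (k + 1) v₀ := fun h => hfar (by
      have := mem_ball_trans h (mem_ball_comm.1 hw')
      rwa [show 2 * k + 1 = k + 1 + k by ring])
    exact ⟨fun h => hcon (h ▸ ball_mono (Nat.le_succ k) _ hu'),
      fun h => hcon (mem_ball_trans hu' (mem_ball_of_adj h))⟩

/-! ### The multiplicity bound -/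

/-- The choice of `R` and `L` for given `θ`, `δ` and `κ`, with bounds in terms of `μ = c + 1`. -/
theorem exists_radii {μ : ℝ} (hμ : 1.99 ≤ μ) :
    ∃ R L : ℕ, ∃ κ : ℝ, 0 < L ∧ 0 ≤ κ ∧
      κ ≤ (1 - 1 / (40 * μ ^ 3)) * (2 / (9 * μ ^ 4)) ∧
      R * (κ / ((1 - 1 / (40 * μ ^ 3)) * (2 / (9 * μ ^ 4)))) ≤ 1 / (40 * μ ^ 3) ∧
      1 ≤ R * ((1 - 1 / (40 * μ ^ 3)) * (2 / (9 * μ ^ 4))) ^ 2 ∧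
      μ ^ 2 / 4 ≤ L * κ ∧ (2 * (R + L : ℕ) + 1 : ℝ) ≤ 2000 * μ ^ 17 := by
  have hμ0 : 0 < μ := by linarith
  have h3 : 7.88 ≤ μ ^ 3 := by
    calc (7.88 : ℝ) ≤ 1.99 ^ 3 := by norm_num
      _ ≤ μ ^ 3 := pow_le_pow_left₀ (by norm_num) hμ 3
  have h8 : 245 ≤ μ ^ 8 := by
    calc (245 : ℝ) ≤ 1.99 ^ 8 := by norm_num
      _ ≤ μ ^ 8 := pow_le_pow_left₀ (by norm_num) hμ 8
  have h9 : 480 ≤ μ ^ 9 := by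
    calc (480 : ℝ) ≤ 1.99 ^ 9 := by norm_num
      _ ≤ μ ^ 9 := pow_le_pow_left₀ (by norm_num) hμ 9
  set δ : ℝ := 1 / (40 * μ ^ 3) with hδ
  set σ : ℝ := (1 - δ) * (2 / (9 * μ ^ 4)) with hσ
  have hδ0 : 0 < δ := by positivity
  have hδ1 : δ ≤ 0.01 := by
    rw [hδ, div_le_iff₀ (by positivity)]; linarith
  have hσ1 : 0.22 / μ ^ 4 ≤ σ := by
    rw [hσ]
    have : (2 : ℝ) / (9 * μ ^ 4) = (2 / 9) / μ ^ 4 := by field_simp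
    rw [this, mul_div_assoc']
    exact div_le_div_of_nonneg_right (by linarith) (by positivity)
  have hσ0 : 0 < σ := lt_of_lt_of_le (by positivity) hσ1
  have hσ2 : σ ≤ 1 := by
    rw [hσ]
    have : (2 : ℝ) / (9 * μ ^ 4) ≤ 1 := by
      rw [div_le_one (by positivity)]
      nlinarith
    have h2 : 0 < (2 : ℝ) / (9 * μ ^ 4) := by positivity
    nlinarith
  have hinv : 1 / σ ≤ μ ^ 4 / 0.22 := by
    rw [div_le_div_iff₀ hσ0 (by norm_num)]
    rw [div_le_iff₀ (by positivity)] at hσ1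
    linarith
  set R : ℕ := ⌈1 / σ ^ 2⌉₊ with hR
  have hR1 : 1 / σ ^ 2 ≤ R := Nat.le_ceil _
  have hR2 : (R : ℝ) ≤ 21 * μ ^ 8 := by
    have h1 : (R : ℝ) < 1 / σ ^ 2 + 1 := Nat.ceil_lt_add_one (by positivity)
    have h2 : 1 / σ ^ 2 ≤ (μ ^ 4 / 0.22) ^ 2 := by
      rw [← one_div_pow]
      exact pow_le_pow_left₀ (by positivity) hinv 2
    have h3 : (μ ^ 4 / 0.22) ^ 2 ≤ 20.7 * μ ^ 8 := by
      rw [div_pow, ← pow_mul, div_le_iff₀ (by norm_num)]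
      nlinarith
    linarith
  have hR3 : (1 : ℝ) ≤ R := le_trans (by
    rw [le_div_iff₀ (by positivity)]; nlinarith) hR1
  have hR0 : (0 : ℝ) < R := by linarith
  set κ : ℝ := δ * σ / R with hκ
  have hκ0 : 0 < κ := by positivity
  set L : ℕ := ⌈μ ^ 2 / (4 * κ)⌉₊ with hL
  have hL1 : μ ^ 2 / (4 * κ) ≤ L := Nat.le_ceil _
  have hL2 : (L : ℝ) < μ ^ 2 / (4 * κ) + 1 := Nat.ceil_lt_add_one (by positivity)
  refine ⟨R, L, κ, Nat.ceil_pos.2 (by positivity), hκ0.le, ?_, le_of_eq ?_, ?_, ?_, ?_⟩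
  · rw [hκ, div_le_iff₀ hR0]
    nlinarith [mul_le_mul_of_nonneg_left hR3 hσ0.le]
  · rw [hκ]; field_simp
  · rwa [div_le_iff₀ (by positivity)] at hR1
  · rw [div_le_iff₀ (by positivity)] at hL1
    linarith
  · have h1 : μ ^ 2 / (4 * κ) = 10 * μ ^ 5 * (R * (1 / σ)) := by
      rw [hκ, hδ]; field_simp; ring
    have h2 : (R : ℝ) * (1 / σ) ≤ 21 * μ ^ 8 * (μ ^ 4 / 0.22) :=
      mul_le_mul hR2 hinv (by positivity) (by positivity)
    have h4 : 10 * μ ^ 5 * (R * (1 / σ)) ≤ 10 * μ ^ 5 * (21 * μ ^ 8 * (μ ^ 4 / 0.22)) :=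
      mul_le_mul_of_nonneg_left h2 (by positivity)
    have h5 : 10 * μ ^ 5 * (21 * μ ^ 8 * (μ ^ 4 / 0.22)) = 210 / 0.22 * μ ^ 17 := by ring
    have h6 : 210 / 0.22 * μ ^ 17 ≤ 955 * μ ^ 17 :=
      mul_le_mul_of_nonneg_right (by norm_num) (by positivity)
    have h7 : 480 * μ ^ 8 ≤ μ ^ 17 := by
      rw [show μ ^ 17 = μ ^ 9 * μ ^ 8 by ring]
      exact mul_le_mul_of_nonneg_right h9 (by positivity)
    push_cast
    linarith

/-- The number `N` of vertices absorbs the number `Q` of the exceptional ones. -/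
theorem two_rpow_large {μ : ℝ} (hμ : 1.99 ≤ μ) {N Q : ℝ} (hQ0 : 0 ≤ Q)
    (hQ : Q ≤ 2 ^ (4000 * μ ^ 18)) (hN : 2 ^ ((2 * μ - 1) ^ 20) ≤ N) :
    3 * μ ^ 4 * Q + 2 ≤ 0.11 * N / μ ^ 4 := by
  have hμ0 : 0 < μ := by linarith
  set E := μ ^ 18 with hE
  have h10 : 900 ≤ μ ^ 10 := by
    calc (900 : ℝ) ≤ 1.99 ^ 10 := by norm_num
      _ ≤ μ ^ 10 := pow_le_pow_left₀ (by norm_num) hμ 10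
  have h8 : 245 ≤ μ ^ 8 := by
    calc (245 : ℝ) ≤ 1.99 ^ 8 := by norm_num
      _ ≤ μ ^ 8 := pow_le_pow_left₀ (by norm_num) hμ 8
  have hE1 : 900 * μ ^ 8 ≤ E := by
    rw [hE, show μ ^ 18 = μ ^ 10 * μ ^ 8 by ring]
    exact mul_le_mul_of_nonneg_right h10 (by positivity)
  have hbase : 4001 * E ≤ (2 * μ - 1) ^ 20 := by
    calc 4001 * E ≤ (1.49 ^ 20 * 1.99 ^ 2) * μ ^ 18 :=
          mul_le_mul_of_nonneg_right (by norm_num) (by positivity)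
      _ ≤ 1.49 ^ 20 * μ ^ 2 * μ ^ 18 := by
          have : (1.99 : ℝ) ^ 2 ≤ μ ^ 2 := pow_le_pow_left₀ (by norm_num) hμ 2
          refine mul_le_mul_of_nonneg_right ?_ (by positivity)
          exact mul_le_mul_of_nonneg_left this (by norm_num)
      _ = (1.49 * μ) ^ 20 := by ring
      _ ≤ (2 * μ - 1) ^ 20 := pow_le_pow_left₀ (by positivity) (by linarith) 20
  have hP1 : (1 : ℝ) ≤ 2 ^ (4000 * E) := Real.one_le_rpow (by norm_num) (by positivity)
  have hP2 : E ≤ (2 : ℝ) ^ E := by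
    have h1 : 1 + E * Real.log 2 ≤ Real.exp (E * Real.log 2) := by
      linarith [Real.add_one_le_exp (E * Real.log 2)]
    have h2 : (2 : ℝ) ^ E = Real.exp (E / 2 * Real.log 2) * Real.exp (E / 2 * Real.log 2) := by
      rw [← Real.exp_add, Real.rpow_def_of_pos (by norm_num)]; ring_nf
    have h3 := Real.add_one_le_exp (E / 2 * Real.log 2)
    have h4 : 0.69 < Real.log 2 := by linarith [Real.log_two_gt_d9]
    have hE0 : 10 ≤ E := by linarith
    have h5 : E / 2 * 0.69 ≤ E / 2 * Real.log 2 :=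
      mul_le_mul_of_nonneg_left h4.le (by linarith)
    rw [h2]
    have h6 : E / 4 + 1 ≤ Real.exp (E / 2 * Real.log 2) := by linarith
    nlinarith
  have hN2 : E * (2 : ℝ) ^ (4000 * E) ≤ N := by
    calc E * (2 : ℝ) ^ (4000 * E) ≤ 2 ^ E * 2 ^ (4000 * E) :=
          mul_le_mul_of_nonneg_right hP2 (by linarith)
      _ = 2 ^ (4001 * E) := by
          rw [← Real.rpow_add (by norm_num)]; ring_nf
      _ ≤ 2 ^ ((2 * μ - 1) ^ 20) := Real.rpow_le_rpow_of_exponent_le (by norm_num) hbase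
      _ ≤ N := hN
  have hN3 : 900 * μ ^ 8 * (2 : ℝ) ^ (4000 * E) ≤ N :=
    (mul_le_mul_of_nonneg_right hE1 (by linarith)).trans hN2
  have h4 : 1 ≤ μ ^ 4 := one_le_pow₀ (by linarith)
  rw [le_div_iff₀ (by positivity)]
  set P : ℝ := 2 ^ (4000 * E)
  have h5 : 3 * μ ^ 4 * Q + 2 ≤ 5 * μ ^ 4 * P := by
    have h6 : 3 * μ ^ 4 * Q ≤ 3 * μ ^ 4 * P := mul_le_mul_of_nonneg_left hQ (by positivity)
    nlinarith
  calc (3 * μ ^ 4 * Q + 2) * μ ^ 4 ≤ 5 * μ ^ 4 * P * μ ^ 4 :=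
        mul_le_mul_of_nonneg_right h5 (by positivity)
    _ = 5 * (μ ^ 8 * P) := by ring
    _ ≤ 0.11 * N := by
        have : 0 ≤ μ ^ 8 * P := by positivity
        linarith

theorem add_one_le_two_rpow {μ d : ℝ} (hμ : 1.99 ≤ μ) (hd : d ≤ (μ - 1) ^ 2 + 0.01) :
    d + 1 ≤ 2 ^ (2 * μ) := by
  rw [Real.rpow_def_of_pos (by norm_num)]
  have hl1 : 0.69 < Real.log 2 := by linarith [Real.log_two_gt_d9]
  have hx : 0.69 * μ ≤ Real.log 2 * μ := mul_le_mul_of_nonneg_right hl1.le (by linarith)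
  have h1 : (1 + 0.69 * μ / 2) ^ 4 ≤ Real.exp (Real.log 2 * (2 * μ)) := by
    calc (1 + 0.69 * μ / 2) ^ 4 ≤ Real.exp (Real.log 2 * (2 * μ) / 4) ^ 4 := by
          refine pow_le_pow_left₀ (by linarith) ?_ 4
          linarith [Real.add_one_le_exp (Real.log 2 * (2 * μ) / 4)]
      _ = Real.exp (Real.log 2 * (2 * μ)) := by
          rw [← Real.exp_nat_mul]; congr 1; push_cast; ring
  have h2 : (1 + 0.69 * μ / 2) ^ 4 = 1 + 1.38 * μ + 0.71415 * μ ^ 2 + 0.164254500 * μ ^ 2 * μ +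
      0.01416695062500 * μ ^ 4 := by ring
  have h3 : 1.99 * μ ^ 2 ≤ μ ^ 2 * μ := by nlinarith [sq_nonneg μ]
  have h4 : 0 ≤ μ ^ 4 := by positivity
  nlinarith

/-- The gain from the extra `s = 1 / (3 μ ^ 2)` vertices in each block outweighs the relative error
`δ = 1 / (40 μ ^ 3)` of its mass. -/
theorem gain_le {μ : ℝ} (hμ : 1.99 ≤ μ) :
    1 / ((1 - 1 / (40 * μ ^ 3)) ^ 2 * (μ + 1 / (3 * μ ^ 2))) ≤ 1 / μ - 0.26 / μ ^ 4 := by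
  have hμ0 : 0 < μ := by linarith
  have h3 : 7.88 ≤ μ ^ 3 := by
    calc (7.88 : ℝ) ≤ 1.99 ^ 3 := by norm_num
      _ ≤ μ ^ 3 := pow_le_pow_left₀ (by norm_num) hμ 3
  set t := 1 / μ ^ 3 with ht
  have ht0 : 0 < t := by positivity
  have ht1 : t ≤ 0.13 := by rw [ht, div_le_iff₀ (by positivity)]; linarith
  have e1 : 1 / (40 * μ ^ 3) = t / 40 := by rw [ht]; field_simp
  have e2 : μ + 1 / (3 * μ ^ 2) = μ * (1 + t / 3) := by rw [ht]; field_simp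
  have e3 : 1 / μ - 0.26 / μ ^ 4 = (1 - 0.26 * t) / μ := by rw [ht]; field_simp
  rw [e1, e2, e3, div_le_div_iff₀ (mul_pos (pow_pos (by linarith) 2) (by positivity)) hμ0, one_mul]
  have h : 1 ≤ (1 - 0.26 * t) * ((1 - t / 40) ^ 2 * (1 + t / 3)) := by
    have h1 : (1 - t / 20) * (1 + t / 3) ≤ (1 - t / 40) ^ 2 * (1 + t / 3) :=
      mul_le_mul_of_nonneg_right (by nlinarith) (by linarith)
    have h2 := mul_le_mul_of_nonneg_left h1 (by linarith : 0 ≤ 1 - 0.26 * t)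
    refine le_trans ?_ h2
    nlinarith [mul_pos ht0 ht0, mul_pos (mul_pos ht0 ht0) ht0]
  calc μ = 1 * μ := (one_mul μ).symm
    _ ≤ (1 - 0.26 * t) * ((1 - t / 40) ^ 2 * (1 + t / 3)) * μ :=
        mul_le_mul_of_nonneg_right h hμ0.le
    _ = _ := by ring

/-- If the form `c - A` is nonnegative on the vectors with zero sum, but not everywhere, and the
graph has degrees at most about `c ^ 2` and very many vertices, then the multiplicity of the
eigenvalue `c` is less than the proportion `1 / (c + 1)` of the number of vertices. -/
theorem card_add_two_le (hc : 0.99 ≤ c)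
    (ho : ∀ i j, ∑ u, φ i u * φ j u = if i = j then 1 else 0)
    (hφ : ∀ i u, ∑ v, G.adjMatrix ℝ u v * φ i v = c * φ i u)
    (H : ∀ x : V → ℝ, ∑ u, x u = 0 → 0 ≤ form G c x x) (hneg : ∃ x : V → ℝ, form G c x x < 0)
    (hdeg : ∀ u, (G.degree u : ℝ) ≤ c ^ 2 + 0.01)
    (hN : (2 : ℝ) ^ ((2 * c + 1) ^ 20) ≤ Fintype.card V) :
    (Fintype.card I : ℝ) + 2 ≤ Fintype.card V / (c + 1) := by
  classical
  obtain ⟨μ, rfl⟩ : ∃ μ, c = μ - 1 := ⟨c + 1, by ring⟩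
  have hμ : 1.99 ≤ μ := by linarith
  have hμ0 : 0 < μ := by linarith
  obtain ⟨R, L, κ, hL, hκ, hκσ, hRκ, hRσ, hLκ, hRL⟩ := exists_radii hμ
  set θ : ℝ := 2 / (9 * μ ^ 4) with hθ
  set δ : ℝ := 1 / (40 * μ ^ 3) with hδ
  have h1 : 1 ≤ μ ^ 3 := one_le_pow₀ (by linarith)
  set U : Finset V := univ.filter fun v =>
    NonnegOn G (μ - 1) (ball G (R + L) v) ∧ θ ^ 2 ≤ projKernel φ v v with hU
  set K : Finset V := univ.filter fun v => ¬NonnegOn G (μ - 1) (ball G (R + L) v) with hK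
  have a : Admissible G (μ - 1) φ ((μ - 1) ^ 2 + 0.01) θ δ κ R L U :=
    { orthonormal := ho
      eigen := hφ
      c_pos := by linarith
      degree_le := hdeg
      L_pos := hL
      θ_pos := by positivity
      δ_lt_one := by rw [hδ, div_lt_one (by positivity)]; linarith
      κ_nonneg := hκ
      κ_sq := by
        have hL0 : (0 : ℝ) < L := by exact_mod_cast hL
        have h2 : (μ ^ 2 / 4) ^ 2 ≤ (L * κ) ^ 2 := pow_le_pow_left₀ (by positivity) hLκ 2
        have h3 : (μ - 1) * ((μ - 1) ^ 2 + 0.01) / 2 ≤ (μ ^ 2 / 4) ^ 2 := by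
          nlinarith [sq_nonneg (μ ^ 2 - 4 * μ), sq_nonneg (μ - 4), sq_nonneg μ]
        rw [show (μ - 1) * (((μ - 1) ^ 2 + 0.01) * (1 / (L : ℝ)) ^ 2 / 2) =
          (μ - 1) * ((μ - 1) ^ 2 + 0.01) / 2 / (L : ℝ) ^ 2 by field_simp]
        rw [div_le_iff₀ (by positivity)]
        nlinarith
      κ_le := hκσ
      R_le := hRκ
      le_R := hRσ
      nonneg_ball := fun v hv => (mem_filter.1 hv).2.1
      large := fun v hv => (mem_filter.1 hv).2.2 }
  have hs0 : 0 < 1 / (3 * μ ^ 2) := by positivity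
  have hcard := a.card_le H hneg (s := 1 / (3 * μ ^ 2)) (γ := 1 / (3 * μ ^ 2)) hs0.le hs0 (by
      rw [div_le_iff₀ (by positivity)]
      nlinarith [mul_self_nonneg μ]) (by
      rw [show 1 / (3 * μ ^ 2) + 2 * (1 / (3 * μ ^ 2)) = 1 / μ ^ 2 by field_simp; norm_num]
      exact one_div_le_one_div_of_le (by nlinarith) (by nlinarith))
  have hD : ∀ v, (G.degree v : ℝ) + 1 ≤ 2 ^ (2 * μ) := fun v => add_one_le_two_rpow hμ (hdeg v)
  have hKcard : (K.card : ℝ) ≤ 2 ^ (4000 * μ ^ 18) := by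
    refine (card_not_nonnegOn_le H (by positivity) hD (R + L) K
      fun v hv => (mem_filter.1 hv).2).trans ?_
    rw [← Real.rpow_natCast, ← Real.rpow_mul (by norm_num)]
    refine Real.rpow_le_rpow_of_exponent_le (by norm_num) ?_
    have h4 := mul_le_mul_of_nonneg_left hRL hμ0.le
    push_cast at h4 ⊢
    nlinarith
  have hout : ∑ u ∈ Uᶜ, projKernel φ u u ≤ Fintype.card V * θ ^ 2 + K.card := by
    calc ∑ u ∈ Uᶜ, projKernel φ u u ≤ ∑ u ∈ Uᶜ, (θ ^ 2 + if u ∈ K then 1 else 0) := by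
          refine sum_le_sum fun u hu => ?_
          by_cases huK : u ∈ K
          · rw [if_pos huK]
            nlinarith [projKernel_self_le_one ho u, sq_nonneg θ]
          · rw [if_neg huK, add_zero]
            by_contra! h5
            refine (mem_compl.1 hu) (mem_filter.2 ⟨mem_univ u, ?_, h5.le⟩)
            by_contra h6
            exact huK (mem_filter.2 ⟨mem_univ u, h6⟩)
      _ ≤ ∑ u, (θ ^ 2 + if u ∈ K then 1 else 0) :=
          sum_le_sum_of_subset_of_nonneg (subset_univ _) fun u _ _ => by split_ifs <;> positivity
      _ = Fintype.card V * θ ^ 2 + K.card := by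
          rw [sum_add_distrib]; simp
  have hcoef : 1 + (μ - 1 + ((μ - 1) ^ 2 + 0.01)) / (1 / (3 * μ ^ 2)) ≤ 3 * μ ^ 4 := by
    rw [div_div_eq_mul_div, div_one]
    nlinarith [mul_self_nonneg μ]
  have hcoef0 : 0 ≤ 1 + (μ - 1 + ((μ - 1) ^ 2 + 0.01)) / (1 / (3 * μ ^ 2)) := by
    have : 0 ≤ μ - 1 := by linarith
    positivity
  have hNV : (0 : ℝ) ≤ Fintype.card V := by positivity
  have hbig := two_rpow_large hμ (Q := K.card) (N := Fintype.card V) (by positivity) hKcard (by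
    convert hN using 3; ring)
  have hg := mul_le_mul_of_nonneg_left (gain_le hμ) hNV
  have h6 : (1 + (μ - 1 + ((μ - 1) ^ 2 + 0.01)) / (1 / (3 * μ ^ 2))) *
      ∑ u ∈ Uᶜ, projKernel φ u u ≤ 3 * μ ^ 4 * (Fintype.card V * θ ^ 2 + K.card) :=
    (mul_le_mul_of_nonneg_left hout hcoef0).trans
      (mul_le_mul_of_nonneg_right hcoef (by positivity))
  have h7 : 3 * μ ^ 4 * (Fintype.card V * θ ^ 2) = (4 / 27) * (Fintype.card V / μ ^ 4) := by
    rw [hθ]; field_simp; ring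
  have h8 : (0 : ℝ) ≤ Fintype.card V / μ ^ 4 := by positivity
  have e1 : (μ - 1 + 1 + 1 / (3 * μ ^ 2)) = μ + 1 / (3 * μ ^ 2) := by ring
  rw [e1] at hcard
  rw [show (Fintype.card V : ℝ) * (1 / ((1 - δ) ^ 2 * (μ + 1 / (3 * μ ^ 2)))) =
    Fintype.card V / ((1 - δ) ^ 2 * (μ + 1 / (3 * μ ^ 2))) by ring] at hg
  rw [show (Fintype.card V : ℝ) * (1 / μ - 0.26 / μ ^ 4) =
    Fintype.card V / μ - 0.26 * (Fintype.card V / μ ^ 4) by ring] at hg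
  rw [show 0.11 * (Fintype.card V : ℝ) / μ ^ 4 = 0.11 * (Fintype.card V / μ ^ 4) by ring] at hbig
  rw [show μ - 1 + 1 = μ by ring]
  linarith

end

section

variable {V : Type*} [Fintype V] [DecidableEq V] {G : SimpleGraph V} [DecidableRel G.Adj] {c : ℝ}

/-! ### Graphs of spectral radius at most `c` -/

theorem abs_eigen_of_form_nonpos (H : ∀ x : V → ℝ, 0 ≤ form G c x x) {x : V → ℝ}
    (hx : form G c x x ≤ 0) (u : V) : ∑ v, G.adjMatrix ℝ u v * x v = c * x u := by
  have h0 : form G c x x = 0 := le_antisymm hx (H x)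
  have h := NonnegOn.abs_eigen_le (G := G) (c := c) (Ω := univ) (fun x _ => H x) (x := x)
    (fun u hu => absurd (mem_univ u) hu) le_rfl (by rw [h0]; simp) (mem_univ u)
  have := abs_nonpos_iff.1 h
  linarith

theorem form_eq_zero_of_eigen {x : V → ℝ}
    (hx : ∀ u, ∑ v, G.adjMatrix ℝ u v * x v = c * x u) : form G c x x = 0 := by
  rw [form_eq_sum_mul]
  exact sum_eq_zero fun u _ => by rw [hx, sub_self, mul_zero]

/-- For a graph of spectral radius at most `c`, the eigenspace of `c` is a sublattice, hence the
projection onto it has nonnegative entries. -/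
theorem projKernel_nonneg {I : Type*} [Fintype I] [DecidableEq I] {φ : I → V → ℝ}
    (H : ∀ x : V → ℝ, 0 ≤ form G c x x)
    (hφ : ∀ i u, ∑ v, G.adjMatrix ℝ u v * φ i v = c * φ i u)
    (hrep : ∀ y : V → ℝ, (∀ u, ∑ v, G.adjMatrix ℝ u v * y v = c * y u) →
      ∀ u, ∑ v, projKernel φ u v * y v = y u) (v u : V) : 0 ≤ projKernel φ v u := by
  set p : V → ℝ := projKernel φ v with hp
  have hpe : ∀ u, ∑ w, G.adjMatrix ℝ u w * p w = c * p u := projKernel_eigen hφ v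
  have h1 := form_posPart_add_negPart_le (G := G) (c := c) p
  rw [form_eq_zero_of_eigen hpe] at h1
  have h2 := hrep (fun u => max (-p u) 0)
    (abs_eigen_of_form_nonpos H (by linarith [H fun u => max (p u) 0])) v
  have h3 : ∀ w, p w * max (-p w) 0 = -(max (-p w) 0) ^ 2 := fun w => by
    rcases le_total 0 (p w) with h | h
    · rw [max_eq_right (neg_nonpos.2 h)]; ring
    · rw [max_eq_left (neg_nonneg.2 h)]; ring
  have h4 : ∑ w, max (-p w) 0 ^ 2 ≤ 0 := by
    have : ∑ w, p w * max (-p w) 0 = -∑ w, max (-p w) 0 ^ 2 := by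
      rw [← sum_neg_distrib]; exact sum_congr rfl fun w _ => h3 w
    have h5 : ∑ w, p w * max (-p w) 0 = max (-p v) 0 := h2
    linarith [le_max_right (-p v) 0]
  have h5 := (single_le_sum (f := fun w => max (-p w) 0 ^ 2) (fun w _ => sq_nonneg _)
    (mem_univ u)).trans h4
  have h6 : max (-p u) 0 = 0 := pow_eq_zero_iff two_ne_zero |>.1 (le_antisymm h5 (sq_nonneg _))
  have := le_max_left (-p u) 0
  linarith

/-- In a graph of spectral radius at most `c`, the multiplicity of the eigenvalue `c` is at most
the proportion `1 / (c + 1)` of the number of vertices: compare the projection `Π` onto the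
eigenspace with `A + 1`, which is at most the all-ones matrix. -/
theorem mul_card_le {I : Type*} [Fintype I] [DecidableEq I] {φ : I → V → ℝ}
    (H : ∀ x : V → ℝ, 0 ≤ form G c x x)
    (ho : ∀ i j, ∑ u, φ i u * φ j u = if i = j then 1 else 0)
    (hφ : ∀ i u, ∑ v, G.adjMatrix ℝ u v * φ i v = c * φ i u)
    (hrep : ∀ y : V → ℝ, (∀ u, ∑ v, G.adjMatrix ℝ u v * y v = c * y u) →
      ∀ u, ∑ v, projKernel φ u v * y v = y u) :
    (c + 1) * Fintype.card I ≤ Fintype.card V := by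
  have hnn := projKernel_nonneg H hφ hrep
  set s := ∑ u, ∑ v, projKernel φ u v with hs
  have h1 : (c + 1) * Fintype.card I ≤ s := by
    rw [← sum_projKernel_self ho, mul_sum]
    refine sum_le_sum fun u _ => ?_
    have h2 : (c + 1) * projKernel φ u u =
        ∑ v, (G.adjMatrix ℝ u v + if u = v then 1 else 0) * projKernel φ u v := by
      simp only [add_mul, sum_add_distrib, projKernel_eigen hφ, ite_mul, one_mul, zero_mul,
        sum_ite_eq, mem_univ, if_true]
    rw [h2]
    refine sum_le_sum fun v _ => mul_le_of_le_one_left (hnn u v) ?_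
    by_cases huv : u = v
    · subst huv; simp [SimpleGraph.adjMatrix_apply]
    · rw [SimpleGraph.adjMatrix_apply, if_neg huv]; split_ifs <;> norm_num
  have h2 : ∑ u, (∑ v, projKernel φ u v) ^ 2 = s := by
    have h3 : ∀ u, (∑ v, projKernel φ u v) ^ 2 =
        ∑ v, ∑ w, projKernel φ v u * projKernel φ w u := fun u => by
      rw [sq, sum_mul_sum]
      exact sum_congr rfl fun v _ => sum_congr rfl fun w _ => by
        rw [projKernel_comm u v, projKernel_comm u w]
    simp only [h3]
    rw [sum_comm]
    refine sum_congr rfl fun v _ => ?_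
    rw [sum_comm]
    refine sum_congr rfl fun w _ => ?_
    rw [projKernel_comm v w, ← hrep (projKernel φ w) (projKernel_eigen hφ w) v]
  have h3 : s ^ 2 ≤ Fintype.card V * s := by
    have := sq_sum_le_card_mul_sum_sq (s := univ) (f := fun u => ∑ v, projKernel φ u v)
    rw [h2] at this
    simpa using this
  have hs0 : 0 ≤ s := sum_nonneg fun u _ => sum_nonneg fun v _ => hnn u v
  have hN : (0 : ℝ) ≤ Fintype.card V := by positivity
  nlinarith

/-! ### From vectors to eigenvectors -/

theorem exists_orthonormal_family (W : Submodule ℝ (EuclideanSpace ℝ V)) :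
    ∃ φ : Fin (Module.finrank ℝ W) → V → ℝ,
      (∀ i j, ∑ u, φ i u * φ j u = if i = j then 1 else 0) ∧
      (∀ i, WithLp.toLp 2 (φ i) ∈ W) ∧
      ∀ y ∈ W, ∀ u, ∑ v, projKernel φ u v * y v = y u := by
  set b := stdOrthonormalBasis ℝ W
  have hin : ∀ x y : EuclideanSpace ℝ V, inner ℝ x y = ∑ u, x u * y u := fun x y => by
    rw [PiLp.inner_apply]
    exact sum_congr rfl fun u _ => by simp [mul_comm]
  refine ⟨fun i u => (b i : EuclideanSpace ℝ V) u, fun i j => ?_, fun i => (b i).2,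
    fun y hy u => ?_⟩
  · have := orthonormal_iff_ite.1 b.orthonormal i j
    rwa [Submodule.coe_inner, hin] at this
  · have h1 := congrArg (fun z : W => (z : EuclideanSpace ℝ V) u) (b.sum_repr' ⟨y, hy⟩)
    simp only [Submodule.coe_sum, Submodule.coe_smul, Submodule.coe_inner, hin] at h1
    rw [← h1]
    simp only [projKernel, WithLp.ofLp_sum, Finset.sum_apply, WithLp.ofLp_smul, Pi.smul_apply,
      smul_eq_mul, sum_mul]
    rw [sum_comm]
    exact sum_congr rfl fun i _ => sum_congr rfl fun v _ => by ring

section vectors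

variable {E : Type*} [NormedAddCommGroup E] [InnerProductSpace ℝ E] {v : V → E} {α : ℝ}

theorem inner_sum_eq (hα : α ≠ 0)
    (hv : ∀ u w, inner ℝ (v u) (v w) = if u = w then 1 else if G.Adj u w then -α else α)
    (x : V → ℝ) (w : V) :
    inner ℝ (v w) (∑ u, x u • v u) = 2 * α * ((1 - α) / (2 * α) * x w -
      ∑ u, G.adjMatrix ℝ w u * x u) + α * ∑ u, x u := by
  have h1 : ∀ u, x u * inner ℝ (v w) (v u) = (if w = u then (1 - α) * x u else 0) -
      2 * α * (G.adjMatrix ℝ w u * x u) + α * x u := fun u => by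
    rw [hv, SimpleGraph.adjMatrix_apply]
    by_cases h : w = u
    · subst h; simp; ring
    · by_cases h' : G.Adj w u <;> simp [h, h'] <;> ring
  rw [inner_sum]
  simp only [inner_smul_right, h1, sum_add_distrib, sum_sub_distrib, sum_ite_eq, mem_univ, if_true,
    ← mul_sum]
  field_simp

theorem norm_sq_sum_eq (hα : α ≠ 0)
    (hv : ∀ u w, inner ℝ (v u) (v w) = if u = w then 1 else if G.Adj u w then -α else α)
    (x : V → ℝ) :
    ‖∑ u, x u • v u‖ ^ 2 = 2 * α * form G ((1 - α) / (2 * α)) x x + α * (∑ u, x u) ^ 2 := by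
  rw [← real_inner_self_eq_norm_sq, sum_inner, form_eq_sum_mul, mul_sum]
  simp only [inner_smul_left, inner_sum_eq hα hv, RCLike.conj_to_real, mul_add, sum_add_distrib]
  congr 1
  · exact sum_congr rfl fun u _ => by ring
  · rw [← sum_mul]; ring

open Module in
/-- The bound for unit vectors with inner products `±α`, where `G` is the graph of negative inner
products and `c = (1 - α) / (2 α)`. Only if `G` has an eigenvalue larger than `c`, its degrees must be
bounded and the vectors be numerous. -/
theorem card_le_of_vectors [FiniteDimensional ℝ E] (hα₀ : 0 < α) (hα₁ : α < 1)
    (hv : ∀ u w, inner ℝ (v u) (v w) = if u = w then 1 else if G.Adj u w then -α else α)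
    (hc : (1 - α) / (2 * α) + 1 ≤ finrank ℝ E)
    (hlarge : (∃ x : V → ℝ, form G ((1 - α) / (2 * α)) x x < 0) →
      0.99 ≤ (1 - α) / (2 * α) ∧ (∀ u, (G.degree u : ℝ) ≤ ((1 - α) / (2 * α)) ^ 2 + 0.01) ∧
      (2 : ℝ) ^ ((1 / α) ^ 20) ≤ Fintype.card V) :
    (Fintype.card V : ℝ) ≤ (1 + 2 * α / (1 - α)) * (finrank ℝ E - 1) := by
  set c := (1 - α) / (2 * α) with hcdef
  have hc0 : 0 < c := div_pos (by linarith) (by linarith)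
  have hcα : 1 + 2 * α / (1 - α) = (c + 1) / c := by
    have : 1 - α ≠ 0 := by linarith
    rw [hcdef]; field_simp
  have hN0 : (0 : ℝ) ≤ Fintype.card V := by positivity
  -- It suffices to bound the defect `N - r` by `N / (c + 1) - 1`.
  suffices h : (c + 1) * (Fintype.card V - finrank ℝ E + 1) ≤ Fintype.card V by
    rw [hcα, div_mul_eq_mul_div, le_div_iff₀ hc0]
    linarith
  have hE : (Fintype.card V : ℝ) = finrank ℝ (EuclideanSpace ℝ V) := by
    rw [finrank_euclideanSpace]
  let ev : V → EuclideanSpace ℝ V →ₗ[ℝ] ℝ := fun u => (EuclideanSpace.proj u).toLinearMap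
  let T : EuclideanSpace ℝ V →ₗ[ℝ] E := ∑ u, (ev u).smulRight (v u)
  have hT : ∀ x, T x = ∑ u, x u • v u := fun x => by simp [T, ev]
  let σ : EuclideanSpace ℝ V →ₗ[ℝ] ℝ := ∑ u, ev u
  have hσ : ∀ x, σ x = ∑ u, x u := fun x => by simp [σ, ev]
  -- A linear dependency of zero sum is an eigenvector.
  have heig : ∀ x, T x = 0 → σ x = 0 → ∀ u, ∑ w, G.adjMatrix ℝ u w * x w = c * x u := by
    intro x hx hs u
    have h1 := inner_sum_eq hα₀.ne' hv x u
    rw [← hT, hx, inner_zero_right, ← hσ, hs, mul_zero, add_zero] at h1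
    have h2 := (mul_eq_zero.1 h1.symm).resolve_left (by positivity)
    linarith
  by_cases hneg : ∃ x : V → ℝ, form G c x x < 0
  · obtain ⟨h99, hdeg, hN⟩ := hlarge hneg
    have hker := LinearMap.finrank_range_add_finrank_ker (T.prod σ)
    have hrange : finrank ℝ (LinearMap.range (T.prod σ)) ≤ finrank ℝ E + 1 := by
      refine (Submodule.finrank_le _).trans ?_
      rw [finrank_prod, finrank_self]
    obtain ⟨φ, ho, hW, -⟩ := exists_orthonormal_family (LinearMap.ker (T.prod σ))
    have hmem : ∀ i, T (WithLp.toLp 2 (φ i)) = 0 ∧ σ (WithLp.toLp 2 (φ i)) = 0 := fun i =>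
      Prod.ext_iff.1 (LinearMap.mem_ker.1 (hW i))
    have hmain := card_add_two_le (G := G) (c := c) h99 ho
      (fun i u => heig _ (hmem i).1 (hmem i).2 u)
      (fun x hx => by
        have h1 := norm_sq_sum_eq hα₀.ne' hv x
        rw [hx] at h1
        have h2 : 0 ≤ 2 * α * form G c x x := by
          have := sq_nonneg ‖∑ u, x u • v u‖
          linarith
        exact nonneg_of_mul_nonneg_right h2 (by linarith)) hneg hdeg
      (by convert hN using 3; rw [hcdef]; field_simp; ring)
    rw [Fintype.card_fin, le_div_iff₀ (by linarith)] at hmain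
    have h1 : (finrank ℝ (EuclideanSpace ℝ V) : ℝ) ≤ finrank ℝ E + 1 +
        finrank ℝ (LinearMap.ker (T.prod σ)) := by
      rw [← hker]; push_cast
      have : (finrank ℝ (LinearMap.range (T.prod σ)) : ℝ) ≤ finrank ℝ E + 1 := by
        exact_mod_cast hrange
      linarith
    rw [← hE] at h1
    nlinarith
  · push Not at hneg
    have hker := LinearMap.finrank_range_add_finrank_ker T
    have hrange : finrank ℝ (LinearMap.range T) ≤ finrank ℝ E := Submodule.finrank_le _
    have h1 : (Fintype.card V : ℝ) ≤ finrank ℝ E + finrank ℝ (LinearMap.ker T) := by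
      rw [hE, ← hker]; push_cast
      have : (finrank ℝ (LinearMap.range T) : ℝ) ≤ finrank ℝ E := by exact_mod_cast hrange
      linarith
    -- Both nonnegative summands of the norm vanish on the kernel of `T`.
    have hzero : ∀ x, T x = 0 → σ x = 0 := by
      intro x hx
      have h2 := norm_sq_sum_eq hα₀.ne' hv x
      rw [← hT, hx, norm_zero, ← hσ] at h2
      have h3 := mul_nonneg (by linarith : 0 ≤ 2 * α) (hneg x)
      have h4 : α * σ x ^ 2 ≤ 0 := by
        rw [zero_pow two_ne_zero] at h2; linarith
      have h5 : σ x ^ 2 ≤ 0 := nonpos_of_mul_nonpos_right h4 hα₀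
      exact pow_eq_zero_iff two_ne_zero |>.1 (le_antisymm h5 (sq_nonneg _))
    by_cases hbot : LinearMap.ker T = ⊥
    · rw [hbot, finrank_bot, Nat.cast_zero, add_zero] at h1
      nlinarith
    · obtain ⟨y, hy, hy0⟩ := Submodule.exists_mem_ne_zero_of_ne_bot hbot
      rw [LinearMap.mem_ker] at hy
      let F : Submodule ℝ (EuclideanSpace ℝ V) :=
        ⨅ u, LinearMap.ker (∑ w, G.adjMatrix ℝ u w • ev w - c • ev u)
      have hF : ∀ x, x ∈ F ↔ ∀ u, ∑ w, G.adjMatrix ℝ u w * x w = c * x u := fun x => by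
        simp only [F, Submodule.mem_iInf, LinearMap.mem_ker, LinearMap.sub_apply,
          LinearMap.sum_apply, LinearMap.smul_apply, sub_eq_zero]
        rfl
      obtain ⟨φ, ho, hφF, hrep⟩ := exists_orthonormal_family F
      have hmain := mul_card_le hneg ho (fun i => (hF _).1 (hφF i))
        (fun z hz u => hrep (WithLp.toLp 2 z) ((hF _).2 hz) u)
      rw [Fintype.card_fin] at hmain
      have hlt : LinearMap.ker T < F := by
        refine lt_of_le_of_ne (fun x hx => (hF x).2 (heig x hx (hzero x hx))) fun heq => ?_
        -- The modulus of a nonzero dependency is an eigenvector with nonzero sum.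
        have habs : WithLp.toLp 2 (fun u => |y u|) ∈ F := (hF _).2
          (abs_eigen_of_form_nonpos hneg ((form_abs_le y).trans
            (form_eq_zero_of_eigen (heig y hy (hzero y hy))).le))
        rw [← heq] at habs
        have h2 := hzero _ habs
        rw [hσ] at h2
        have h3 := (sum_eq_zero_iff_of_nonneg fun u _ => abs_nonneg (y u)).1 h2
        exact hy0 (by ext u; simpa using h3 u (mem_univ u))
      have h2 : finrank ℝ (LinearMap.ker T) + 1 ≤ finrank ℝ F := Submodule.finrank_lt_finrank_of_lt hlt
      have h3 : (finrank ℝ (LinearMap.ker T) : ℝ) + 1 ≤ finrank ℝ F := by exact_mod_cast h2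
      nlinarith

end vectors

end

section

variable {V : Type*}

/-! ### Switching to small degrees -/

/-- A quantitative form of Ramsey's theorem for graphs. -/
theorem exists_clique_or_indep [DecidableEq V] (r : V → V → Prop) [DecidableRel r]
    (hr : ∀ u w, r u w → r w u) (s t : ℕ) (A : Finset V) (hA : 2 ^ (s + t) ≤ A.card) :
    (∃ B ⊆ A, B.card = s ∧ ∀ u ∈ B, ∀ w ∈ B, u ≠ w → r u w) ∨
      ∃ B ⊆ A, B.card = t ∧ ∀ u ∈ B, ∀ w ∈ B, u ≠ w → ¬r u w := by
  induction hn : s + t generalizing s t A with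
  | zero =>
    refine Or.inl ⟨∅, empty_subset _, ?_, by simp⟩
    rw [card_empty]; omega
  | succ n ih =>
    rcases s with _ | s
    · exact Or.inl ⟨∅, empty_subset _, rfl, by simp⟩
    rcases t with _ | t
    · exact Or.inr ⟨∅, empty_subset _, rfl, by simp⟩
    rw [hn] at hA
    obtain ⟨v, hv⟩ : A.Nonempty := card_pos.1 (lt_of_lt_of_le (by positivity) hA)
    set A₁ := (A.erase v).filter fun u => r v u
    set A₂ := (A.erase v).filter fun u => ¬r v u
    have hcard : A₁.card + A₂.card = A.card - 1 := by
      rw [card_filter_add_card_filter_not, card_erase_of_mem hv]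
    have hA₁ : A₁ ⊆ A := (filter_subset _ _).trans (erase_subset _ _)
    have hA₂ : A₂ ⊆ A := (filter_subset _ _).trans (erase_subset _ _)
    have h1 : 2 ^ n ≤ A₁.card ∨ 2 ^ n ≤ A₂.card := by
      have : 2 ^ (n + 1) = 2 * 2 ^ n := by ring
      omega
    have hv₁ : v ∉ A₁ := fun h => by simp [A₁] at h
    have hv₂ : v ∉ A₂ := fun h => by simp [A₂] at h
    rcases h1 with h1 | h1
    · rcases ih s (t + 1) A₁ (by rwa [show s + (t + 1) = n by omega]) (by omega) with
        ⟨B, hB, hc, hB'⟩ | ⟨B, hB, hc, hB'⟩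
      · refine Or.inl ⟨insert v B, insert_subset hv (hB.trans hA₁), ?_, ?_⟩
        · rw [card_insert_of_notMem fun h => hv₁ (hB h), hc]
        · have hvB : ∀ w ∈ B, r v w := fun w hw => (mem_filter.1 (hB hw)).2
          intro u hu w hw huw
          rcases mem_insert.1 hu with hu | hu <;> rcases mem_insert.1 hw with hw | hw
          · exact absurd (hu.trans hw.symm) huw
          · exact hu ▸ hvB w hw
          · exact hw ▸ hr _ _ (hvB u hu)
          · exact hB' u hu w hw huw
      · exact Or.inr ⟨B, hB.trans hA₁, hc, hB'⟩
    · rcases ih (s + 1) t A₂ (by rwa [show s + 1 + t = n by omega]) (by omega) with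
        ⟨B, hB, hc, hB'⟩ | ⟨B, hB, hc, hB'⟩
      · exact Or.inl ⟨B, hB.trans hA₂, hc, hB'⟩
      · refine Or.inr ⟨insert v B, insert_subset hv (hB.trans hA₂), ?_, ?_⟩
        · rw [card_insert_of_notMem fun h => hv₂ (hB h), hc]
        · have hvB : ∀ w ∈ B, ¬r v w := fun w hw => (mem_filter.1 (hB hw)).2
          intro u hu w hw huw
          rcases mem_insert.1 hu with hu | hu <;> rcases mem_insert.1 hw with hw | hw
          · exact absurd (hu.trans hw.symm) huw
          · exact hu ▸ hvB w hw
          · exact fun h => hvB u hu (hr _ _ (hw ▸ h))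
          · exact hB' u hu w hw huw

variable {E : Type*} [NormedAddCommGroup E] [InnerProductSpace ℝ E] {α : ℝ}

/-- The squared norm of `τ z₀ + ∑ z x` is nonnegative: for a suitable `τ`, this bounds the number of
almost orthogonal vectors that have a given negative inner product with `z₀`. -/
theorem star_nonneg {S : Finset V} {z₀ : E} {z : V → E} {A e B : ℝ}
    (h₀ : inner ℝ z₀ z₀ ≤ A + e) (h₁ : ∀ x ∈ S, inner ℝ z₀ (z x) ≤ -B)
    (h₂ : ∀ x ∈ S, ∀ y ∈ S, x ≠ y → inner ℝ (z x) (z y) ≤ e)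
    (h₃ : ∀ x ∈ S, inner ℝ (z x) (z x) ≤ A + e) {τ : ℝ} (hτ : 0 ≤ τ) :
    0 ≤ τ ^ 2 * (A + e) - 2 * τ * (S.card * B) + (S.card * A + S.card ^ 2 * e) := by
  classical
  have h4 : inner ℝ z₀ (∑ x ∈ S, z x) ≤ -(S.card * B) := by
    rw [inner_sum]
    calc ∑ x ∈ S, inner ℝ z₀ (z x) ≤ ∑ x ∈ S, -B := sum_le_sum h₁
      _ = -(S.card * B) := by rw [sum_const, nsmul_eq_mul]; ring
  have h5 : inner ℝ (∑ x ∈ S, z x) (∑ x ∈ S, z x) ≤ S.card * A + S.card ^ 2 * e := by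
    rw [sum_inner]
    simp only [inner_sum]
    calc ∑ x ∈ S, ∑ y ∈ S, inner ℝ (z x) (z y)
        ≤ ∑ x ∈ S, ∑ y ∈ S, ((if x = y then A else 0) + e) := by
          refine sum_le_sum fun x hx => sum_le_sum fun y hy => ?_
          by_cases hxy : x = y
          · subst hxy; rw [if_pos rfl]; exact h₃ x hx
          · rw [if_neg hxy, zero_add]; exact h₂ x hx y hy hxy
      _ = S.card * A + S.card ^ 2 * e := by
          simp [sum_add_distrib]
          ring
  have h6 : 0 ≤ inner ℝ (τ • z₀ + ∑ x ∈ S, z x) (τ • z₀ + ∑ x ∈ S, z x) := real_inner_self_nonneg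
  rw [inner_add_left, inner_add_right, inner_add_right, real_inner_smul_left, real_inner_smul_right,
    real_inner_smul_left, real_inner_smul_right, real_inner_comm z₀ (∑ x ∈ S, z x)] at h6
  have h7 := mul_le_mul_of_nonneg_left h₀ (sq_nonneg τ)
  have h8 := mul_le_mul_of_nonneg_left h4 hτ
  nlinarith

theorem norm_sq_sum_of_pairwise [DecidableEq V] {v : V → E}
    (hunit : ∀ u, inner ℝ (v u) (v u) = (1 : ℝ))
    {X : Finset V} (hX : ∀ x ∈ X, ∀ y ∈ X, x ≠ y → inner ℝ (v x) (v y) = α) (k : V → ℝ) :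
    inner ℝ (∑ x ∈ X, k x • v x) (∑ x ∈ X, k x • v x) =
      (1 - α) * ∑ x ∈ X, k x ^ 2 + α * (∑ x ∈ X, k x) ^ 2 := by
  rw [sum_inner]
  simp only [inner_sum, real_inner_smul_left, real_inner_smul_right]
  rw [sq (∑ x ∈ X, k x), sum_mul_sum, mul_sum, mul_sum, ← sum_add_distrib]
  refine sum_congr rfl fun x hx => ?_
  calc ∑ y ∈ X, k y * (k x * inner ℝ (v x) (v y))
      = ∑ y ∈ X, ((if x = y then (1 - α) * k x ^ 2 else 0) + α * (k x * k y)) := by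
        refine sum_congr rfl fun y hy => ?_
        by_cases hxy : x = y
        · subst hxy; rw [if_pos rfl, hunit]; ring
        · rw [if_neg hxy, hX x hx y hy hxy]; ring
    _ = _ := by rw [sum_add_distrib, sum_ite_eq, if_pos hx, mul_sum]

/-- A unit vector with inner products `±α` with a large set of vectors with pairwise inner products
`α` has few negative ones among them, if at most half of them are negative. -/
theorem card_neg_le [DecidableEq V] {v : V → E} (hunit : ∀ u, inner ℝ (v u) (v u) = (1 : ℝ))
    {X : Finset V} (hX : ∀ x ∈ X, ∀ y ∈ X, x ≠ y → inner ℝ (v x) (v y) = α) (hα₀ : 0 < α)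
    (hα₁ : α < 1) {w : E} (hw : inner ℝ w w = (1 : ℝ))
    (hwX : ∀ x ∈ X, inner ℝ w (v x) = α ∨ inner ℝ w (v x) = -α)
    (hhalf : 2 * (X.filter fun x => inner ℝ w (v x) < 0).card ≤ X.card) :
    2 * α ^ 2 * (X.filter fun x => inner ℝ w (v x) < 0).card ≤ 1 - α := by
  set Y := X.filter fun x => inner ℝ w (v x) < 0 with hY
  set Z := X.filter fun x => ¬inner ℝ w (v x) < 0 with hZ
  set a : ℝ := (Y.card : ℝ) with ha
  set b : ℝ := (Z.card : ℝ) with hb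
  have hab : Y.card + Z.card = X.card := card_filter_add_card_filter_not _
  have hab' : a ≤ b := by
    have : Y.card ≤ Z.card := by omega
    rw [ha, hb]; exact_mod_cast this
  rcases Nat.eq_zero_or_pos Y.card with h0 | hpos
  · rw [ha, h0]; simp; linarith
  have ha0 : 0 < a := by rw [ha]; exact_mod_cast hpos
  -- Test `w` against the combination of `X` with coefficients of zero sum that is constant on the
  -- positive and on the negative part.
  set k : V → ℝ := fun x => if inner ℝ w (v x) < 0 then -b else a with hk
  have hsum : ∀ p q : ℝ, ∑ x ∈ X, (if inner ℝ w (v x) < 0 then p else q) = a * p + b * q := by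
    intro p q
    rw [sum_ite, sum_const, sum_const, nsmul_eq_mul, nsmul_eq_mul]
  have h1 : ∑ x ∈ X, k x = 0 := by rw [hsum]; ring
  have h2 : ∑ x ∈ X, k x ^ 2 = a * b ^ 2 + b * a ^ 2 := by
    have : ∀ x, k x ^ 2 = if inner ℝ w (v x) < 0 then b ^ 2 else a ^ 2 := fun x => by
      simp only [hk]; split_ifs <;> ring
    simp only [this, hsum]
  have h3 : inner ℝ w (∑ x ∈ X, k x • v x) = 2 * a * b * α := by
    rw [inner_sum]
    have : ∀ x ∈ X, inner ℝ w (k x • v x) = if inner ℝ w (v x) < 0 then b * α else a * α := by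
      intro x hx
      rw [real_inner_smul_right]
      rcases hwX x hx with h | h
      · rw [h, if_neg (by linarith)]; simp only [hk]; rw [h, if_neg (by linarith)]
      · rw [h, if_pos (by linarith)]; simp only [hk]; rw [h, if_pos (by linarith)]; ring
    rw [sum_congr rfl this, hsum]; ring
  have h4 := real_inner_mul_inner_self_le w (∑ x ∈ X, k x • v x)
  rw [norm_sq_sum_of_pairwise hunit hX k, h1, h2, h3, hw] at h4
  have hb0 : 0 < b := by linarith
  have hpos2 : 0 < a * b ^ 2 := by positivity
  have h5 : 2 * α ^ 2 * a * (a * b ^ 2) ≤ (1 - α) * (a * b ^ 2) := by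
    have : (1 - α) * (b * a ^ 2) ≤ (1 - α) * (a * b ^ 2) := by
      refine mul_le_mul_of_nonneg_left ?_ (by linarith)
      nlinarith [mul_pos ha0 hb0]
    nlinarith
  exact le_of_mul_le_mul_right h5 hpos2

end

section

variable {V : Type*}

theorem le_sq_add_of_star {α t D : ℝ} (hα₀ : 0 < α) (hα : α ≤ 1 / 2) (ht : 0.49 * (1 / α) ^ 20 ≤ t)
    (hD : 0 ≤ D)
    (h : 0 ≤ (D / ((1 - α) / (2 * α))) ^ 2 * (1 - α + 3 / (α * t)) -
      2 * (D / ((1 - α) / (2 * α))) * (D * (2 * α - 3 / (α * t))) +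
      (D * (1 - α) + D ^ 2 * (3 / (α * t)))) :
    D ≤ ((1 - α) / (2 * α)) ^ 2 + 0.01 := by
  rcases hD.eq_or_lt with rfl | hD0
  · positivity
  set l := (1 - α) / (2 * α) with hl
  have hA : 1 - α = 2 * α * l := by rw [hl]; field_simp
  have hl1 : 1 / 2 ≤ l := by rw [hl, div_le_div_iff₀ (by norm_num) (by linarith)]; linarith
  have hl0 : 0 < l := by linarith
  have hl2 : l + 1 ≤ 1 / α := by
    rw [hl, div_add_one (by positivity), div_le_div_iff₀ (by positivity) hα₀]; nlinarith
  have hp : 2 ≤ 1 / α := by rw [le_div_iff₀ hα₀]; linarith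
  have ht0 : 0 < t := lt_of_lt_of_le (by positivity) ht
  set e := 3 / (α * t) with he
  have he0 : 0 < e := by positivity
  set ξ := e * (l + 1) ^ 2 / (2 * α * l) with hξ
  have hξ0 : 0 ≤ ξ := by positivity
  have h1 : D * (1 - ξ) ≤ l ^ 2 := by
    have e1 : (D / l) ^ 2 * (1 - α + e) - 2 * (D / l) * (D * (2 * α - e)) +
        (D * (1 - α) + D ^ 2 * e) = (2 * α * D / l) * (l ^ 2 - D * (1 - ξ)) := by
      rw [hA, hξ]; field_simp; ring
    rw [e1] at h
    have := nonneg_of_mul_nonneg_right h (by positivity)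
    linarith
  have h2 : ξ ≤ 3 / (α ^ 4 * t) := by
    rw [hξ]
    calc e * (l + 1) ^ 2 / (2 * α * l) ≤ e * (1 / α) ^ 2 / α := by
          refine div_le_div₀ (by positivity) ?_ hα₀ (by nlinarith)
          exact mul_le_mul_of_nonneg_left (pow_le_pow_left₀ (by linarith) hl2 2) he0.le
      _ = 3 / (α ^ 4 * t) := by rw [he]; field_simp
  have h3 : 3 / (α ^ 4 * t) ≤ 6.2 / (1 / α) ^ 16 := by
    rw [div_le_div_iff₀ (by positivity) (by positivity)]
    have h4 : α ^ 4 * (0.49 * (1 / α) ^ 20) ≤ α ^ 4 * t :=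
      mul_le_mul_of_nonneg_left ht (by positivity)
    have h5 : α ^ 4 * (0.49 * (1 / α) ^ 20) = 0.49 * (1 / α) ^ 16 := by field_simp
    have h6 : 0 ≤ (1 / α) ^ 16 := by positivity
    linarith
  have hp14 : 2 ^ 14 ≤ (1 / α) ^ 14 := pow_le_pow_left₀ (by norm_num) hp 14
  have hp2 : 2 ^ 2 ≤ (1 / α) ^ 2 := pow_le_pow_left₀ (by norm_num) hp 2
  have h4 : l ^ 2 * (2 * ξ) ≤ 0.01 := by
    have h5 : l ^ 2 ≤ (1 / α) ^ 2 := pow_le_pow_left₀ hl0.le (by linarith) 2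
    calc l ^ 2 * (2 * ξ) ≤ (1 / α) ^ 2 * (2 * (6.2 / (1 / α) ^ 16)) :=
          mul_le_mul h5 (by linarith) (by positivity) (by positivity)
      _ = 12.4 / (1 / α) ^ 14 := by field_simp; norm_num
      _ ≤ 0.01 := by rw [div_le_iff₀ (by positivity)]; linarith
  have h5 : ξ ≤ 1 / 2 := by
    refine h2.trans (h3.trans ?_)
    rw [div_le_iff₀ (by positivity), show (1 / α) ^ 16 = (1 / α) ^ 14 * (1 / α) ^ 2 by ring]
    nlinarith
  -- `1 / (1 - ξ) ≤ 1 + 2 ξ`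
  have h6 : D ≤ D * (1 - ξ) * (1 + 2 * ξ) := by
    have : 0 ≤ D * (ξ * (1 - 2 * ξ)) :=
      mul_nonneg hD (mul_nonneg hξ0 (by linarith))
    linarith
  have h7 := mul_le_mul_of_nonneg_right h1 (by linarith : 0 ≤ 1 + 2 * ξ)
  linarith

theorem pairwise_of_switched {V E : Type*} [NormedAddCommGroup E] [InnerProductSpace ℝ E] {α : ℝ}
    {v w : V → E}
    (hv : ∀ u x, u ≠ x → inner ℝ (v u) (v x) = α ∨ inner ℝ (v u) (v x) = -α)
    (hw : ∀ u, w u = v u ∨ w u = -v u) (u x : V) (hux : u ≠ x) :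
    inner ℝ (w u) (w x) = α ∨ inner ℝ (w u) (w x) = -α := by
  rcases hw u with h | h <;> rcases hw x with h' | h' <;>
    simp only [h, h', inner_neg_left, inner_neg_right] <;>
    rcases hv u x hux with h'' | h'' <;> simp [h'']

variable [Fintype V] {E : Type*} [NormedAddCommGroup E] [InnerProductSpace ℝ E] {α : ℝ}

/-- A large system of unit vectors with inner products `±α` contains a large set with pairwise
inner products `α`: large sets with pairwise inner products `-α` do not exist. -/
theorem exists_large_positive (hα₀ : 0 < α) (hα : α ≤ 1 / 2) {v : V → E}
    (hunit : ∀ u, inner ℝ (v u) (v u) = (1 : ℝ))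
    (hv : ∀ u w, u ≠ w → inner ℝ (v u) (v w) = α ∨ inner ℝ (v u) (v w) = -α)
    (hN : (2 : ℝ) ^ ((1 / α) ^ 20) ≤ Fintype.card V) :
    ∃ X : Finset V, 0.49 * (1 / α) ^ 20 ≤ X.card ∧
      ∀ x ∈ X, ∀ y ∈ X, x ≠ y → inner ℝ (v x) (v y) = α := by
  classical
  have hp : 2 ≤ 1 / α := by rw [le_div_iff₀ hα₀]; linarith
  set y := (1 / α) ^ 20 with hy
  have hy1 : 2 ^ 19 * (1 / α) ≤ y := by
    rw [hy, show (1 / α) ^ 20 = (1 / α) ^ 19 * (1 / α) by ring]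
    exact mul_le_mul_of_nonneg_right (pow_le_pow_left₀ (by norm_num) hp 19) (by positivity)
  have hy0 : 0 ≤ y := by positivity
  set m := ⌊y / 2⌋₊ with hm
  have hm1 : y / 2 < m + 1 := Nat.lt_floor_add_one _
  have hm2 : (m : ℝ) ≤ y / 2 := Nat.floor_le (by positivity)
  have hcard : 2 ^ (m + m) ≤ (univ : Finset V).card := by
    have : (2 : ℝ) ^ (m + m) ≤ Fintype.card V := by
      refine le_trans ?_ hN
      rw [← Real.rpow_natCast]
      refine Real.rpow_le_rpow_of_exponent_le (by norm_num) ?_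
      push_cast; linarith
    rw [card_univ]
    exact_mod_cast this
  rcases exists_clique_or_indep (fun u w => inner ℝ (v u) (v w) < 0)
    (fun u w h => by rwa [real_inner_comm]) m m univ hcard with ⟨B, -, hB, hneg⟩ | ⟨B, -, hB, hpos⟩
  · exfalso
    have h1 := norm_sq_sum_of_pairwise (α := -α) hunit (X := B) (fun x hx w hw hxw => by
      rcases hv x w hxw with h | h
      · have := hneg x hx w hw hxw
        linarith
      · exact h) (fun _ => 1)
    have h2 : (0 : ℝ) ≤ inner ℝ (∑ x ∈ B, (1 : ℝ) • v x) (∑ x ∈ B, (1 : ℝ) • v x) :=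
      real_inner_self_nonneg
    rw [h1] at h2
    simp only [one_pow, sum_const, hB, nsmul_eq_mul, mul_one] at h2
    have hm0 : (0 : ℝ) < m := by linarith
    have h3 : 0 ≤ (m : ℝ) * (1 + α - α * m) := by nlinarith
    have h4 := nonneg_of_mul_nonneg_right h3 hm0
    have h5 : α * (3 * (1 / α)) ≤ α * m := mul_le_mul_of_nonneg_left (by linarith) hα₀.le
    have h6 : α * (3 * (1 / α)) = 3 := by field_simp
    linarith
  · refine ⟨B, ?_, fun x hx w hw hxw => ?_⟩
    · rw [hB]; linarith
    · rcases hv x w hxw with h | h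
      · exact h
      · exact absurd (by rw [h]; linarith) (hpos x hx w hw hxw)

/-- After changing signs, every vector of a large system of unit vectors with inner products `±α`
has few negative inner products with the others. -/
theorem exists_switching (hα₀ : 0 < α) (hα : α ≤ 1 / 2) {v : V → E}
    (hunit : ∀ u, inner ℝ (v u) (v u) = (1 : ℝ))
    (hv : ∀ u w, u ≠ w → inner ℝ (v u) (v w) = α ∨ inner ℝ (v u) (v w) = -α)
    (hN : (2 : ℝ) ^ ((1 / α) ^ 20) ≤ Fintype.card V) :
    ∃ w : V → E, (∀ u, w u = v u ∨ w u = -v u) ∧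
      ∀ u, ∀ S : Finset V, (∀ x ∈ S, x ≠ u ∧ inner ℝ (w u) (w x) < 0) →
        (S.card : ℝ) ≤ ((1 - α) / (2 * α)) ^ 2 + 0.01 := by
  classical
  obtain ⟨X, hXcard, hX⟩ := exists_large_positive hα₀ hα hunit hv hN
  set t : ℝ := (X.card : ℝ) with ht
  have ht0 : 0 < t := lt_of_lt_of_le (by positivity) hXcard
  set w : V → E := fun u =>
    if 2 * (X.filter fun x => inner ℝ (v u) (v x) < 0).card ≤ X.card then v u else -v u with hw
  have hwv : ∀ u, w u = v u ∨ w u = -v u := fun u => by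
    simp only [hw]; split_ifs
    · exact Or.inl rfl
    · exact Or.inr rfl
  have hw1 : ∀ u, inner ℝ (w u) (w u) = (1 : ℝ) := fun u => by
    rcases hwv u with h | h <;> simp only [h, inner_neg_neg, hunit]
  have hww := pairwise_of_switched hv hwv
  have hwX : ∀ u, ∀ x, u ≠ x → inner ℝ (w u) (v x) = α ∨ inner ℝ (w u) (v x) = -α := by
    intro u x hux
    rcases hwv u with h | h <;> simp only [h, inner_neg_left] <;>
      rcases hv u x hux with h'' | h'' <;> simp [h'']
  set η : ℝ := 1 / (α * t) with hη
  have hη0 : 0 < η := by positivity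
  -- All vectors have inner product close to `α` with the barycentre of `X`.
  set b : E := (1 / t) • ∑ x ∈ X, v x with hb
  have hbb : inner ℝ b b ≤ α + η := by
    have h1 := norm_sq_sum_of_pairwise hunit hX (fun _ => 1)
    simp only [one_smul, one_pow, sum_const, nsmul_eq_mul, mul_one] at h1
    rw [hb, real_inner_smul_left, real_inner_smul_right, h1, ← ht, hη]
    have h2 : 1 / t * (1 / t * ((1 - α) * t + α * t ^ 2)) = α + (1 - α) / t := by field_simp; ring
    rw [h2]
    have h3 : (1 - α) / t ≤ 1 / (α * t) := by
      rw [div_le_div_iff₀ ht0 (by positivity)]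
      have : (1 - α) * α ≤ 1 := by nlinarith
      nlinarith
    linarith
  have hwb : ∀ u, α - η ≤ inner ℝ (w u) b := by
    intro u
    have hib : inner ℝ (w u) b = 1 / t * ∑ x ∈ X, inner ℝ (w u) (v x) := by
      rw [hb, real_inner_smul_right, inner_sum]
    rw [hib]
    by_cases hu : u ∈ X
    · have hpos : ∀ x ∈ X, α ≤ inner ℝ (v u) (v x) := fun x hx => by
        by_cases hux : u = x
        · subst hux; rw [hunit]; linarith
        · rw [hX u hu x hx hux]
      have hwu : w u = v u := by
        simp only [hw]
        rw [if_pos]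
        rw [filter_false_of_mem fun x hx => not_lt.2 (hα₀.le.trans (hpos x hx))]
        simp
      have h1 : t * α ≤ ∑ x ∈ X, inner ℝ (w u) (v x) := by
        rw [hwu]
        calc t * α = ∑ x ∈ X, α := by rw [sum_const, nsmul_eq_mul]
          _ ≤ _ := sum_le_sum hpos
      have h2 := mul_le_mul_of_nonneg_left h1 (by positivity : 0 ≤ 1 / t)
      have h3 : 1 / t * (t * α) = α := by field_simp
      linarith
    · have hne : ∀ x ∈ X, u ≠ x := fun x hx h => hu (h ▸ hx)
      have hhalf : 2 * (X.filter fun x => inner ℝ (w u) (v x) < 0).card ≤ X.card := by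
        by_cases h : 2 * (X.filter fun x => inner ℝ (v u) (v x) < 0).card ≤ X.card
        · have : w u = v u := by simp only [hw]; rw [if_pos h]
          rwa [this]
        · have h1 : w u = -v u := by simp only [hw]; rw [if_neg h]
          have h2 : (X.filter fun x => inner ℝ (w u) (v x) < 0) =
              X.filter fun x => ¬inner ℝ (v u) (v x) < 0 := by
            refine filter_congr fun x hx => ?_
            rw [h1, inner_neg_left]
            rcases hv u x (hne x hx) with h3 | h3 <;> rw [h3] <;> constructor <;> intro <;> linarith
          rw [h2]
          have := card_filter_add_card_filter_not (s := X) fun x => inner ℝ (v u) (v x) < 0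
          omega
      have hcn := card_neg_le hunit hX hα₀ (by linarith) (hw1 u)
        (fun x hx => hwX u x (hne x hx)) hhalf
      set a : ℝ := ((X.filter fun x => inner ℝ (w u) (v x) < 0).card : ℝ) with ha
      have h1 : ∑ x ∈ X, inner ℝ (w u) (v x) = t * α - 2 * α * a := by
        have h2 : ∀ x ∈ X, inner ℝ (w u) (v x) =
            α - if inner ℝ (w u) (v x) < 0 then 2 * α else 0 := fun x hx => by
          rcases hwX u x (hne x hx) with h | h
          · rw [h, if_neg (by linarith)]; ring
          · rw [h, if_pos (by linarith)]; ring
        rw [sum_congr rfl h2, sum_sub_distrib, sum_ite, sum_const, sum_const, sum_const_zero,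
          nsmul_eq_mul, nsmul_eq_mul]
        ring
      rw [h1]
      have h2 : 1 / t * (t * α - 2 * α * a) = α - 2 * α ^ 2 * a / (α * t) := by field_simp
      have h3 : 2 * α ^ 2 * a / (α * t) ≤ η :=
        div_le_div_of_nonneg_right (by linarith) (by positivity)
      linarith
  refine ⟨w, hwv, fun u S hS => ?_⟩
  have hz : ∀ x y, inner ℝ (w x - b) (w y - b) ≤ inner ℝ (w x) (w y) - α + 3 * η := by
    intro x y
    rw [inner_sub_left, inner_sub_right, inner_sub_right, real_inner_comm (w y) b]
    linarith [hwb x, hwb y]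
  have h3 : 3 * η = 3 / (α * t) := by rw [hη]; ring
  have hl0 : 0 < (1 - α) / (2 * α) := div_pos (by linarith) (by linarith)
  have hle : ∀ x y, x ≠ y → inner ℝ (w x) (w y) ≤ α := fun x y hxy => by
    rcases hww x y hxy with h | h <;> rw [h]
    linarith
  have hstar := star_nonneg (S := S) (z₀ := w u - b) (z := fun x => w x - b) (A := 1 - α)
    (e := 3 / (α * t)) (B := 2 * α - 3 / (α * t))
    (by have := hz u u; rw [hw1] at this; linarith)
    (fun x hx => by
      have h4 := hS x hx
      have h5 : inner ℝ (w u) (w x) = -α := by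
        rcases hww u x h4.1.symm with h | h
        · linarith [h4.2]
        · exact h
      have := hz u x
      linarith)
    (fun x hx y hy hxy => by linarith [hz x y, hle x y hxy])
    (fun x hx => by have := hz x x; rw [hw1] at this; linarith)
    (τ := S.card / ((1 - α) / (2 * α))) (by positivity)
  exact le_sq_add_of_star hα₀ hα hXcard (by positivity) hstar

end

section

/-! ### The bound for finite and for arbitrary families -/

section

variable {V : Type*} {E : Type*} [NormedAddCommGroup E] [InnerProductSpace ℝ E] {α : ℝ}

/-- The graph of negative inner products of a system of vectors. -/
def negGraph (w : V → E) : SimpleGraph V where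
  Adj u x := u ≠ x ∧ inner ℝ (w u) (w x) < (0 : ℝ)
  symm := ⟨fun u x h => ⟨h.1.symm, by rw [real_inner_comm]; exact h.2⟩⟩
  loopless := ⟨fun _ h => h.1 rfl⟩

open Classical in
theorem inner_eq_of_negGraph (hα₀ : 0 < α) {w : V → E} (hw1 : ∀ u, inner ℝ (w u) (w u) = (1 : ℝ))
    (hww : ∀ u x, u ≠ x → inner ℝ (w u) (w x) = α ∨ inner ℝ (w u) (w x) = -α) (u x : V) :
    inner ℝ (w u) (w x) = if u = x then 1 else if (negGraph w).Adj u x then -α else α := by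
  by_cases hux : u = x
  · subst hux; rw [if_pos rfl, hw1]
  · rw [if_neg hux]
    rcases hww u x hux with h | h
    · rw [if_neg fun h' => by linarith [h'.2], h]
    · rw [if_pos ⟨hux, by rw [h]; linarith⟩, h]

theorem form_nonneg_of_no_edge [Fintype V] [DecidableEq V] {G : SimpleGraph V} [DecidableRel G.Adj]
    {c : ℝ} (hc : 0 ≤ c) (hG : ∀ u x, ¬G.Adj u x) (x : V → ℝ) : 0 ≤ form G c x x := by
  rw [form_eq]
  simp only [SimpleGraph.adjMatrix_apply, hG, if_false, zero_mul, sum_const_zero, sub_zero]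
  exact mul_nonneg hc (sum_nonneg fun u _ => mul_self_nonneg _)

/-- For `α > 1 / 2` there are no three unit vectors with pairwise inner products `-α`, hence all
signs can be made positive. -/
theorem exists_switching_of_half_lt (hα₀ : 0 < α) (hα : 1 / 2 < α) [Nonempty V] {v : V → E}
    (hunit : ∀ u, inner ℝ (v u) (v u) = (1 : ℝ))
    (hv : ∀ u w, u ≠ w → inner ℝ (v u) (v w) = α ∨ inner ℝ (v u) (v w) = -α) :
    ∃ w : V → E, (∀ u, w u = v u ∨ w u = -v u) ∧ ∀ u x, ¬(negGraph w).Adj u x := by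
  classical
  obtain ⟨v₀⟩ := ‹Nonempty V›
  set w : V → E := fun u => if inner ℝ (v v₀) (v u) < (0 : ℝ) then -v u else v u with hw
  have hwv : ∀ u, w u = v u ∨ w u = -v u := fun u => by
    simp only [hw]; split_ifs
    · exact Or.inr rfl
    · exact Or.inl rfl
  have hw1 : ∀ u, inner ℝ (w u) (w u) = (1 : ℝ) := fun u => by
    rcases hwv u with h | h <;> simp only [h, inner_neg_neg, hunit]
  have hww := pairwise_of_switched hv hwv
  have hw₀ : w v₀ = v v₀ := by simp only [hw]; rw [if_neg (by rw [hunit]; norm_num)]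
  have hpos : ∀ u, u ≠ v₀ → inner ℝ (w v₀) (w u) = α := fun u hu => by
    rw [hw₀]
    simp only [hw]
    rcases hv v₀ u hu.symm with h | h
    · rw [if_neg (by rw [h]; linarith), h]
    · rw [if_pos (by rw [h]; linarith), inner_neg_right, h, neg_neg]
  refine ⟨w, hwv, fun u x hux => ?_⟩
  have hneg : inner ℝ (w u) (w x) = -α := (hww u x hux.1).resolve_left fun h => by
    have := hux.2
    linarith
  have hu : u ≠ v₀ := by
    rintro rfl
    have := hpos x hux.1.symm
    linarith
  have hx : x ≠ v₀ := by
    rintro rfl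
    have := hpos u hux.1
    rw [real_inner_comm] at this
    linarith
  have h : (0 : ℝ) ≤ inner ℝ (w u + w x - w v₀) (w u + w x - w v₀) := real_inner_self_nonneg
  have e1 : inner ℝ (w u) (w v₀) = α := by rw [real_inner_comm, hpos u hu]
  have e2 : inner ℝ (w x) (w v₀) = α := by rw [real_inner_comm, hpos x hx]
  have e3 : inner ℝ (w x) (w u) = -α := by rw [real_inner_comm, hneg]
  simp only [inner_sub_left, inner_sub_right, inner_add_left, inner_add_right, hw1, hneg,
    hpos u hu, hpos x hx, e1, e2, e3] at h
  linarith

open Module in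
/-- The bound for a finite system of unit vectors with inner products `±α`. -/
theorem card_le_of_unit_vectors [Fintype V] [FiniteDimensional ℝ E] (hα₀ : 0 < α) (hα₁ : α < 1)
    (hr : (2 : ℝ) ^ ((1 / α) ^ 20) ≤ finrank ℝ E) {v : V → E}
    (hunit : ∀ u, inner ℝ (v u) (v u) = (1 : ℝ))
    (hv : ∀ u w, u ≠ w → inner ℝ (v u) (v w) = α ∨ inner ℝ (v u) (v w) = -α) :
    (Fintype.card V : ℝ) ≤ (1 + 2 * α / (1 - α)) * (finrank ℝ E - 1) := by
  classical
  set c := (1 - α) / (2 * α) with hc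
  have hc0 : 0 < c := div_pos (by linarith) (by linarith)
  have hp : 1 ≤ 1 / α := by rw [le_div_iff₀ hα₀]; linarith
  have hcr : c + 1 ≤ finrank ℝ E := by
    refine le_trans ?_ hr
    have h1 : c + 1 ≤ 1 / α := by
      rw [hc, div_add_one (by positivity), div_le_div_iff₀ (by positivity) hα₀]; nlinarith
    have h2 : 1 / α ≤ (1 / α) ^ 20 := le_self_pow₀ hp (by norm_num)
    have h3 := one_add_mul_self_le_rpow_one_add (s := 1) (p := (1 / α) ^ 20) (by norm_num)
      (hp.trans h2)
    norm_num at h3 h1 h2 ⊢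
    linarith
  by_contra! hlt
  -- The bound exceeds the dimension.
  have hbound : (finrank ℝ E : ℝ) ≤ (1 + 2 * α / (1 - α)) * (finrank ℝ E - 1) := by
    have : 1 + 2 * α / (1 - α) = (c + 1) / c := by
      have : 1 - α ≠ 0 := by linarith
      rw [hc]; field_simp
    rw [this, div_mul_eq_mul_div, le_div_iff₀ hc0]
    nlinarith
  have hN : (2 : ℝ) ^ ((1 / α) ^ 20) ≤ Fintype.card V := hr.trans (hbound.trans hlt.le)
  have hne : Nonempty V := by
    rw [← Fintype.card_pos_iff]
    have : (0 : ℝ) < Fintype.card V := lt_of_lt_of_le (by positivity) hN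
    exact_mod_cast this
  rcases le_or_gt α (1 / 2) with hα | hα
  · obtain ⟨w, hwv, hdeg⟩ := exists_switching hα₀ hα hunit hv hN
    have hw1 : ∀ u, inner ℝ (w u) (w u) = (1 : ℝ) := fun u => by
      rcases hwv u with h | h <;> simp only [h, inner_neg_neg, hunit]
    have hdeg' : ∀ u, ((negGraph w).degree u : ℝ) ≤ c ^ 2 + 0.01 := fun u => by
      rw [← SimpleGraph.card_neighborFinset_eq_degree]
      exact hdeg u _ fun x hx => by
        rw [SimpleGraph.mem_neighborFinset] at hx
        exact ⟨hx.1.symm, hx.2⟩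
    refine absurd (card_le_of_vectors (G := negGraph w) hα₀ hα₁
      (inner_eq_of_negGraph hα₀ hw1 (pairwise_of_switched hv hwv)) hcr fun hneg =>
      ⟨?_, hdeg', hN⟩) (not_le.2 hlt)
    -- A negative vector requires an edge, hence a vertex of positive degree.
    obtain ⟨x, hx⟩ := hneg
    have : ∃ u y, (negGraph w).Adj u y := by
      by_contra! hG
      exact absurd (form_nonneg_of_no_edge hc0.le hG x) (not_le.2 hx)
    obtain ⟨u, y, huy⟩ := this
    have h1 : 1 ≤ (negGraph w).degree u :=
      ((negGraph w).degree_pos_iff_exists_adj u).2 ⟨y, huy⟩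
    have h2 : (1 : ℝ) ≤ c ^ 2 + 0.01 := le_trans (by exact_mod_cast h1) (hdeg' u)
    by_contra! h3
    nlinarith
  · obtain ⟨w, hwv, hG⟩ := exists_switching_of_half_lt hα₀ hα hunit hv
    have hw1 : ∀ u, inner ℝ (w u) (w u) = (1 : ℝ) := fun u => by
      rcases hwv u with h | h <;> simp only [h, inner_neg_neg, hunit]
    refine absurd (card_le_of_vectors (G := negGraph w) hα₀ hα₁
      (inner_eq_of_negGraph hα₀ hw1 (pairwise_of_switched hv hwv)) hcr fun ⟨x, hx⟩ => ?_)
      (not_le.2 hlt)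
    exact absurd (form_nonneg_of_no_edge hc0.le hG x) (not_le.2 hx)

theorem inner_eq_of_acuteAngle (hα₀ : 0 < α) (hα₁ : α < 1) {x y : E} (hx : ‖x‖ = 1) (hy : ‖y‖ = 1)
    (h : acuteAngle x y = Real.arccos α) : inner ℝ x y = α ∨ inner ℝ x y = -α := by
  have h1 := InnerProductGeometry.cos_angle_mul_norm_mul_norm x y
  rw [hx, hy, mul_one, mul_one] at h1
  have h2 : Real.cos (Real.arccos α) = α := Real.cos_arccos (by linarith) hα₁.le
  rw [← h1, ← h2, ← h, acuteAngle]
  rcases min_choice (InnerProductGeometry.angle x y) (Real.pi - InnerProductGeometry.angle x y)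
    with h3 | h3 <;> rw [h3]
  · exact Or.inl rfl
  · right; rw [Real.cos_pi_sub, neg_neg]

theorem exists_unit_of_finrank_eq_one {L : Submodule ℝ E} (hL : Module.finrank ℝ L = 1) :
    ∃ x ∈ L, ‖x‖ = 1 := by
  have hbot : L ≠ ⊥ := by rintro rfl; simp at hL
  obtain ⟨x, hx, hx0⟩ := Submodule.exists_mem_ne_zero_of_ne_bot hbot
  exact ⟨‖x‖⁻¹ • x, L.smul_mem _ hx, norm_smul_inv_norm hx0⟩

end

theorem card_finset_le {α : ℝ} (hα₀ : 0 < α) (hα₁ : α < 1) {r : ℕ}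
    (hr : (2 : ℝ) ^ (1 / α ^ 20 : ℝ) ≤ (r : ℝ))
    {S : Set (Submodule ℝ (EuclideanSpace ℝ (Fin r)))} (hS : IsEquiangularLines α S)
    (T : Finset (Submodule ℝ (EuclideanSpace ℝ (Fin r)))) (hT : ↑T ⊆ S) :
    (T.card : ℝ) ≤ (1 + 2 * α / (1 - α)) * ((r : ℝ) - 1) := by
  choose! f hfL hf1 using fun L (hL : L ∈ S) => exists_unit_of_finrank_eq_one (hS.1 L hL)
  have h0 : ∀ L ∈ S, f L ≠ 0 := fun L hL h => by
    have := hf1 L hL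
    rw [h, norm_zero] at this
    exact zero_ne_one this
  have h := card_le_of_unit_vectors (V := T) (v := fun L => f L) hα₀ hα₁
    (by rwa [finrank_euclideanSpace, Fintype.card_fin, one_div_pow])
    (fun L => by rw [real_inner_self_eq_norm_sq, hf1 _ (hT L.2), one_pow])
    (fun L L' hne => inner_eq_of_acuteAngle hα₀ hα₁ (hf1 _ (hT L.2)) (hf1 _ (hT L'.2))
      (hS.2 L (hT L.2) L' (hT L'.2) (fun h => hne (Subtype.ext h)) _ (hfL _ (hT L.2)) _
        (hfL _ (hT L'.2)) (h0 _ (hT L.2)) (h0 _ (hT L'.2))))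
  rwa [finrank_euclideanSpace, Fintype.card_fin, Fintype.card_coe] at h

end

end Equiangular

theorem theorem3p4 (α : ℝ) (hα₀ : 0 < α) (hα₁ : α < 1) (r : ℕ)
    (hr : (2 : ℝ) ^ (1 / α ^ 20 : ℝ) ≤ (r : ℝ))
    (S : Set (Submodule ℝ (EuclideanSpace ℝ (Fin r))))
    (hS : IsEquiangularLines α S) :
    S.Finite ∧
      (S.ncard : ℤ) ≤ ⌊(1 + 2 * α / (1 - α)) * ((r : ℝ) - 1)⌋ := by
  have hfin : S.Finite := by
    by_contra hinf
    obtain ⟨T, hT, hcard⟩ := Set.Infinite.exists_subset_card_eq hinf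
      (⌊(1 + 2 * α / (1 - α)) * ((r : ℝ) - 1)⌋₊ + 1)
    have h1 := Equiangular.card_finset_le hα₀ hα₁ hr hS T hT
    rw [hcard] at h1
    push_cast at h1
    exact absurd (Nat.lt_floor_add_one ((1 + 2 * α / (1 - α)) * ((r : ℝ) - 1))) (not_lt.2 h1)
  refine ⟨hfin, Int.le_floor.2 ?_⟩
  have h1 := Equiangular.card_finset_le hα₀ hα₁ hr hS hfin.toFinset (by simp)
  rwa [← Set.ncard_eq_toFinset_card S hfin] at h1
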